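/- Let $\mathcal S(\mathbb R)$ be the Schwartz space and consider on $L^2(\mathbb R)$ the operator $$(\Pi\psi)(x)=i\,x\,\frac{d}{dx}\big[x\,\psi(x)\big],\qquad \psi\in\mathcal S(\mathbb R).$$ Let $\Pi$ also denote its closure, with domain $\mathcal D_0$, the closure of $\mathcal S(\mathbb R)$ in the graph norm $(\|\psi\|^2+\|\Pi\psi\|^2)^{1/2}$. For $\theta\in\mathbb R$ put $$\zeta_\theta(x)=\frac1x\,e^{-1/|x|}\,e^{i\,\mathrm{sgn}(x)\theta/2},\qquad (L_\theta\psi)(x)=e^{i\,\mathrm{sgn}(x)\theta/2}\,\psi(x),$$ so that $\zeta_\theta\in L^2(\mathbb R)$ and $L_\theta$ is unitary on $L^2(\mathbb R)$. Then: 1. $\Pi$ is a densely defined closed symmetric operator with deficiency indices $(1,1)$, i.e. $\dim\mathrm{Ker}(\Pi^*-i)=\dim\mathrm{Ker}(\Pi^*+i)=1$. 2. For every $\theta$ there is a well-defined operator $\Pi_\theta$ with domain $\mathcal D(\Pi_\theta)=\{\psi+c\,\zeta_\theta : \psi\in\mathcal D_0,\ c\in\mathbb C\}$ and action $\Pi_\theta(\psi+c\,\zeta_\theta)=\Pi\psi+c\,\zeta_{\theta+\pi}$.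 One has $\Pi_{\theta+2\pi}=\Pi_\theta$, and $\theta\mapsto\Pi_\theta$ is a bijection from $[0,2\pi)\simeq\mathbb S^1$ onto the set of all self-adjoint extensions of $\Pi$. 3. All these extensions are unitarily equivalent: $\Pi_\theta=L_\theta\,\Pi_0\,L_\theta^*$ for all $\theta$ (including equality of domains). 4. For all $\theta$ the spectrum of $\Pi_\theta$ is purely absolutely continuous and equal to the real line: for every $\psi\in L^2(\mathbb R)$ the spectral measure of $\Pi_\theta$ at $\psi$ is absolutely continuous with respect to Lebesgue measure, and $\sigma(\Pi_\theta)=\sigma_{\mathrm{ac}}(\Pi_\theta)=\mathbb R$. Here $\sigma_{\mathrm{ac}}(A)$ is the spectrum of the restriction of a self-adjoint operator $A$ to the closed subspace of vectors whose spectral measure is absolutely continuous. -/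

import Mathlib

open MeasureTheory
open scoped SchwartzMap

namespace ThermalHamiltonian

noncomputable section

/-! ### Unbounded operators on a complex Hilbert space -/

section Abstract

variable {H : Type*} [NormedAddCommGroup H] [InnerProductSpace ℂ H]

/-- The resolvent set of an unbounded operator `A`: all `z` such that `A - z` is a bijection
from the domain of `A` onto `H` with a bounded everywhere defined inverse `R`. -/
def resolventSet (A : H →ₗ.[ℂ] H) : Set ℂ :=
  {z | ∃ R : H →L[ℂ] H,
    (∀ y : H, ∃ h : R y ∈ A.domain, A ⟨R y, h⟩ - z • R y = y) ∧
    (∀ x : A.domain, R (A x - z • (x : H)) = x)}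

/-- The spectrum of an unbounded operator. -/
def opSpectrum (A : H →ₗ.[ℂ] H) : Set ℂ := (resolventSet A)ᶜ

/-- The deficiency subspace `Ker (A† - z)`; the deficiency subspaces proper are `z = ± i`. -/
def deficiencySubspace [CompleteSpace H] (A : H →ₗ.[ℂ] H) (z : ℂ) : Submodule ℂ H where
  carrier := {x | ∃ h : x ∈ A.adjoint.domain, A.adjoint ⟨x, h⟩ = z • x}
  zero_mem' := ⟨Submodule.zero_mem _, by
    have h0 : (⟨0, Submodule.zero_mem _⟩ : A.adjoint.domain) = 0 := rfl
    rw [h0, LinearPMap.map_zero, smul_zero]⟩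
  add_mem' := by
    rintro x y ⟨hx, ex⟩ ⟨hy, ey⟩
    refine ⟨Submodule.add_mem _ hx hy, ?_⟩
    have h0 : (⟨x + y, Submodule.add_mem _ hx hy⟩ : A.adjoint.domain) = ⟨x, hx⟩ + ⟨y, hy⟩ := rfl
    rw [h0, LinearPMap.map_add, ex, ey, smul_add]
  smul_mem' := by
    rintro c x ⟨hx, ex⟩
    refine ⟨Submodule.smul_mem _ c hx, ?_⟩
    have h0 : (⟨c • x, Submodule.smul_mem _ c hx⟩ : A.adjoint.domain) = c • ⟨x, hx⟩ := rfl
    rw [h0, LinearPMap.map_smul, ex, smul_comm]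

/-- The deficiency indices `n₊` and `n₋` of `A`, as cardinals. -/
def deficiencyIndices [CompleteSpace H] (A : H →ₗ.[ℂ] H) : Cardinal × Cardinal :=
  (Module.rank ℂ (deficiencySubspace A Complex.I),
    Module.rank ℂ (deficiencySubspace A (-Complex.I)))

/-- The operator `U A U*`, with domain `U (D(A))`. -/
def unitaryConj (U : H ≃ₗᵢ[ℂ] H) (A : H →ₗ.[ℂ] H) : H →ₗ.[ℂ] H where
  domain := A.domain.comap (U.symm.toLinearEquiv : H →ₗ[ℂ] H)
  toFun :=
    { toFun := fun x => U (A ⟨U.symm x, x.2⟩)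
      map_add' := fun x y => by
        rw [← map_add, ← LinearPMap.map_add]
        congr 2
        exact Subtype.ext (map_add U.symm (x : H) (y : H))
      map_smul' := fun c x => by
        rw [RingHom.id_apply, ← map_smul, ← LinearPMap.map_smul]
        congr 2
        exact Subtype.ext (map_smul U.symm c (x : H)) }

/-- The finite Borel measure `μ` is the spectral measure of the self-adjoint operator `A` in the
state `ψ`: its Borel-Stieltjes transform is `z ↦ ⟨ψ, (A - z)⁻¹ ψ⟩` on `ℂ \ ℝ`.
Here `φ = (A - z)⁻¹ ψ`. -/
def IsSpectralMeasure (A : H →ₗ.[ℂ] H) (ψ : H) (μ : Measure ℝ) : Prop :=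
  IsFiniteMeasure μ ∧
    ∀ z : ℂ, z.im ≠ 0 → ∃ φ : A.domain, A φ - z • (φ : H) = ψ ∧
      inner ℂ ψ (φ : H) = ∫ t : ℝ, ((t : ℂ) - z)⁻¹ ∂μ

/-- The vectors whose spectral measure is absolutely continuous with respect to Lebesgue
measure. -/
def acVectors (A : H →ₗ.[ℂ] H) : Set H :=
  {ψ | ∃ μ : Measure ℝ, IsSpectralMeasure A ψ μ ∧ μ ≪ volume}

/-- The absolutely continuous subspace of `A`. For self-adjoint `A` the set `acVectors A` is
already a closed subspace, so that taking the closed span adds nothing. -/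
def acSubspace (A : H →ₗ.[ℂ] H) : Submodule ℂ H :=
  (Submodule.span ℂ (acVectors A)).topologicalClosure

/-- The part of `A` in a subspace `K`: the restriction of `A` to all `x ∈ K ∩ D(A)` with
`A x ∈ K`, as an operator on `K`. If `K` reduces `A`, this is the restriction of `A` to
`K ∩ D(A)`. -/
def partIn (A : H →ₗ.[ℂ] H) (K : Submodule ℂ H) : K →ₗ.[ℂ] K where
  domain :=
    { carrier := {x | ∃ h : (x : H) ∈ A.domain, A ⟨x, h⟩ ∈ K}
      zero_mem' := ⟨Submodule.zero_mem _, by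
        have h0 : A (0 : A.domain) ∈ K := by rw [LinearPMap.map_zero]; exact K.zero_mem
        exact h0⟩
      add_mem' := by
        rintro x y ⟨hx, ex⟩ ⟨hy, ey⟩
        refine ⟨Submodule.add_mem _ hx hy, ?_⟩
        have h0 : A (⟨x, hx⟩ + ⟨y, hy⟩ : A.domain) ∈ K := by
          rw [LinearPMap.map_add]; exact K.add_mem ex ey
        exact h0
      smul_mem' := by
        rintro c x ⟨hx, ex⟩
        refine ⟨Submodule.smul_mem _ c hx, ?_⟩
        have h0 : A (c • ⟨x, hx⟩ : A.domain) ∈ K := by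
          rw [LinearPMap.map_smul]; exact K.smul_mem c ex
        exact h0 }
  toFun :=
    { toFun := fun x => ⟨A ⟨x, x.2.fst⟩, x.2.snd⟩
      map_add' := fun x y => Subtype.ext (A.map_add ⟨x, x.2.fst⟩ ⟨y, y.2.fst⟩)
      map_smul' := fun c x => Subtype.ext (A.map_smul c ⟨x, x.2.fst⟩) }

/-- The absolutely continuous spectrum: the spectrum of the restriction of `A` to its absolutely
continuous subspace. -/
def acSpectrum (A : H →ₗ.[ℂ] H) : Set ℂ := opSpectrum (partIn A (acSubspace A))

end Abstract

/-! ### The operator `i x (d/dx) x` on `L²(ℝ)` -/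

/-- The Hilbert space `L²(ℝ)` of complex valued functions. -/
abbrev L2R : Type := Lp ℂ 2 (volume : Measure ℝ)

/-- Multiplication by the coordinate on Schwartz functions. -/
def mulX : 𝓢(ℝ, ℂ) →ₗ[ℂ] 𝓢(ℝ, ℂ) :=
  (SchwartzMap.smulLeftCLM ℂ (fun x : ℝ => (x : ℂ))).toLinearMap

theorem mulX_apply (f : 𝓢(ℝ, ℂ)) (x : ℝ) : mulX f x = x * f x := by
  have h : Function.HasTemperateGrowth (fun x : ℝ => (x : ℂ)) :=
    Complex.ofRealCLM.hasTemperateGrowth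
  exact SchwartzMap.smulLeftCLM_apply_apply h f x

/-- The differential expression `ψ ↦ i x (d/dx) (x ψ)` on Schwartz functions. -/
def schwartzOp : 𝓢(ℝ, ℂ) →ₗ[ℂ] 𝓢(ℝ, ℂ) :=
  Complex.I • (mulX ∘ₗ (SchwartzMap.derivCLM ℂ ℂ).toLinearMap ∘ₗ mulX)

theorem schwartzOp_apply (f : 𝓢(ℝ, ℂ)) (x : ℝ) :
    schwartzOp f x = Complex.I * (x * deriv (fun y : ℝ => (y : ℂ) * f y) x) := by
  have h : (mulX f : ℝ → ℂ) = fun y : ℝ => (y : ℂ) * f y := funext (mulX_apply f)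
  change Complex.I • (mulX (SchwartzMap.derivCLM ℂ ℂ (mulX f)) x) = _
  rw [mulX_apply, SchwartzMap.derivCLM_apply, h, smul_eq_mul]

/-- The inclusion of the Schwartz space into `L²(ℝ)`. -/
def schwartzIncl : 𝓢(ℝ, ℂ) →ₗ[ℂ] L2R :=
  (SchwartzMap.toLpCLM ℂ ℂ 2 (volume : Measure ℝ)).toLinearMap

theorem schwartzIncl_injective : Function.Injective schwartzIncl :=
  SchwartzMap.injective_toLp 2 (volume : Measure ℝ)

/-- The operator `i x (d/dx) x` in `L²(ℝ)` with domain the Schwartz space. -/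
def opSchwartz : L2R →ₗ.[ℂ] L2R where
  domain := LinearMap.range schwartzIncl
  toFun := schwartzIncl ∘ₗ schwartzOp ∘ₗ
    (LinearEquiv.ofInjective schwartzIncl schwartzIncl_injective).symm.toLinearMap

/-- The operator `Π`: the closure of `i x (d/dx) x` on the Schwartz space. Its domain is the
closure `𝒟₀` of the Schwartz space in the graph norm. -/
def opPi : L2R →ₗ.[ℂ] L2R := opSchwartz.closure

/-- The unimodular function `x ↦ exp (i sgn(x) θ / 2)`. -/
def phase (θ : ℝ) (x : ℝ) : ℂ := Complex.exp (Complex.I * (Real.sign x * (θ / 2) : ℝ))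

theorem norm_phase (θ x : ℝ) : ‖phase θ x‖ = 1 := by
  rw [phase, mul_comm, Complex.norm_exp_ofReal_mul_I]

theorem measurable_phase (θ : ℝ) : Measurable (phase θ) := by
  have hs : Measurable Real.sign := by
    unfold Real.sign
    exact Measurable.ite measurableSet_Iio measurable_const
      (Measurable.ite measurableSet_Ioi measurable_const measurable_const)
  unfold phase
  fun_prop

theorem phase_mul_phase_neg (θ x : ℝ) : phase θ x * phase (-θ) x = 1 := by
  rw [phase, phase, ← Complex.exp_add, ← Complex.exp_zero]
  congr 1
  push_cast
  ring

theorem memLp_phase_mul (θ : ℝ) (f : L2R) :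
    MemLp (fun x => phase θ x * f x) 2 (volume : Measure ℝ) := by
  refine (Lp.memLp f).of_le
    ((measurable_phase θ).aestronglyMeasurable.mul (Lp.aestronglyMeasurable f)) ?_
  filter_upwards with x
  rw [norm_mul, norm_phase, one_mul]

/-- Multiplication by `phase θ` as a linear map. -/
def mulPhase (θ : ℝ) : L2R →ₗ[ℂ] L2R where
  toFun f := (memLp_phase_mul θ f).toLp _
  map_add' f g := by
    apply Lp.ext
    filter_upwards [(memLp_phase_mul θ (f + g)).coeFn_toLp, (memLp_phase_mul θ f).coeFn_toLp,
      (memLp_phase_mul θ g).coeFn_toLp, Lp.coeFn_add f g,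
      Lp.coeFn_add ((memLp_phase_mul θ f).toLp _) ((memLp_phase_mul θ g).toLp _)]
      with x h1 h2 h3 h4 h5
    rw [h1, h5, Pi.add_apply, h2, h3, h4, Pi.add_apply, mul_add]
  map_smul' c f := by
    apply Lp.ext
    filter_upwards [(memLp_phase_mul θ (c • f)).coeFn_toLp, (memLp_phase_mul θ f).coeFn_toLp,
      Lp.coeFn_smul c f, Lp.coeFn_smul c ((memLp_phase_mul θ f).toLp _)]
      with x h1 h2 h3 h4
    rw [RingHom.id_apply, h1, h4, Pi.smul_apply, h2, h3, Pi.smul_apply, smul_eq_mul, smul_eq_mul,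
      mul_left_comm]

theorem mulPhase_coeFn (θ : ℝ) (f : L2R) : mulPhase θ f =ᵐ[volume] fun x => phase θ x * f x :=
  (memLp_phase_mul θ f).coeFn_toLp

theorem mulPhase_mulPhase_neg (θ : ℝ) (f : L2R) : mulPhase θ (mulPhase (-θ) f) = f := by
  apply Lp.ext
  filter_upwards [mulPhase_coeFn θ (mulPhase (-θ) f), mulPhase_coeFn (-θ) f] with x h1 h2
  rw [h1, h2, ← mul_assoc, phase_mul_phase_neg, one_mul]

/-- The unitary operator `(L_θ ψ)(x) = exp (i sgn(x) θ / 2) ψ(x)`. -/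
def unitaryL (θ : ℝ) : L2R ≃ₗᵢ[ℂ] L2R where
  toLinearEquiv := LinearEquiv.ofLinearMap (mulPhase θ) (mulPhase (-θ))
    (LinearMap.ext fun f => mulPhase_mulPhase_neg θ f)
    (LinearMap.ext fun f => by
      have h := mulPhase_mulPhase_neg (-θ) f
      rw [neg_neg] at h
      exact h)
  norm_map' f := by
    change ‖mulPhase θ f‖ = ‖f‖
    rw [Lp.norm_def, Lp.norm_def, eLpNorm_congr_ae (mulPhase_coeFn θ f)]
    congr 1
    apply eLpNorm_congr_norm_ae
    filter_upwards with x
    rw [norm_mul, norm_phase, one_mul]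

/-- The function `ζ_θ(x) = x⁻¹ exp (-1/|x|) exp (i sgn(x) θ / 2)`. -/
def zetaFun (θ : ℝ) (x : ℝ) : ℂ := ((x⁻¹ * Real.exp (-(1 / |x|)) : ℝ) : ℂ) * phase θ x

theorem memLp_zetaFun (θ : ℝ) : MemLp (zetaFun θ) 2 (volume : Measure ℝ) := by
  have hm : Measurable (zetaFun θ) := by
    have := measurable_phase θ
    unfold zetaFun
    fun_prop
  rw [memLp_two_iff_integrable_sq_norm hm.aestronglyMeasurable]
  refine integrable_inv_one_add_sq.mono' (by fun_prop) ?_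
  filter_upwards with x
  have hn : ‖zetaFun θ x‖ ^ 2 = (|x|⁻¹ * Real.exp (-|x|⁻¹)) ^ 2 := by
    rw [zetaFun, norm_mul, norm_phase, mul_one, Complex.norm_real, Real.norm_eq_abs, abs_mul,
      abs_inv, Real.abs_exp, one_div]
  rw [Real.norm_of_nonneg (by positivity), hn]
  rcases eq_or_ne x 0 with rfl | hx
  · simp
  have hx' : 0 < |x| := abs_pos.2 hx
  obtain ⟨t, ht⟩ : ∃ t : ℝ, t = |x|⁻¹ := ⟨_, rfl⟩
  have htp : 0 < t := ht ▸ inv_pos.2 hx'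
  have hx2 : x ^ 2 = (t ^ 2)⁻¹ := by rw [ht, inv_pow, inv_inv, sq_abs]
  have he : 1 + t ≤ Real.exp t := by linarith [Real.add_one_le_exp t]
  have he2 : 1 + t ^ 2 ≤ Real.exp t ^ 2 := by nlinarith
  rw [← ht, hx2, Real.exp_neg, mul_pow, inv_pow]
  have h3 : (1 + (t ^ 2)⁻¹)⁻¹ = t ^ 2 * (1 + t ^ 2)⁻¹ := by
    field_simp
    ring
  rw [h3]
  gcongr

/-- `ζ_θ` as an element of `L²(ℝ)`. -/
def zeta (θ : ℝ) : L2R := (memLp_zetaFun θ).toLp _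

/-- The extension `Π_θ`, given by its graph, which is the graph of `Π` together with the line
spanned by `(ζ_θ, ζ_{θ+π})`. -/
def opPiExt (θ : ℝ) : L2R →ₗ.[ℂ] L2R :=
  (opPi.graph ⊔ Submodule.span ℂ {(zeta θ, zeta (θ + Real.pi))}).toLinearPMap

end

end ThermalHamiltonian

open ThermalHamiltonian

/-!
In the coordinate `u = 1 / x` the operator `Π` is `-i d/du` on the line with the origin removed:
the involution `V f (x) = f (1 / x) / x` is unitary on `L²(ℝ)`, and if `y = G / x`, then
`i x (x y)' = i x G'`. The point `u = 0` corresponds to `x = ±∞`, and a self-adjoint extension of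
`Π` is a phase `exp (i θ)` relating the boundary values of `G` at `x = +∞` and at `x = -∞`.

The extension theory uses only that `Π` is closed, symmetric and densely defined, with
one-dimensional deficiency subspaces spanned by vectors `e₊`, `e₋` of equal norm (`DefectOne`).
Von Neumann's formula (`DefectOne.exists_of_mem_adjoint`) decomposes the graph of the adjoint, the
boundary form (`DefectOne.inner_defectPair_sub`) then singles out the vectors `α e₊ + β e₋` with
`|α| = |β|`, and `ζ_θ` is `exp (i θ / 2) e₊ + exp (-i θ / 2) e₋`. Here `e₊` and `e₋` are the
restrictions of `ζ_0` to the two half-lines.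

Symmetry, and membership in the domain of the adjoint, all come from one Green formula
(`IsRep.inner_eq`). The deficiency subspaces are computed with the du Bois-Reymond lemma, which
gives the multiples of `exp (∓ 1 / x) / x` on each half-line (`exists_ae_eq_of_mem_adjoint`); on one
of the two half-lines this function is not square integrable. Since `e₊` and `e₋` are eigenvectors
of `L_θ`, the unitary `L_θ` preserves the graph of `Π` and shifts the angle of the extensions.

For `θ = 0` there is no jump at `u = 0`, so that `Π_0` is `-i d/du` on the whole line, and the
Fourier transform turns it into multiplication by `2 π ξ` (`isDiagonalizedBy_opPiExt_zero`). The
resolvent, the spectrum and the spectral measures can be read off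
(`IsDiagonalizedBy.opSpectrum_eq`, `IsDiagonalizedBy.mem_acVectors`).
-/

open Filter Topology
open scoped ContDiff FourierTransform

namespace ThermalHamiltonian

noncomputable section

/-! ### Symmetric operators with deficiency indices `(1, 1)` -/

section Defect

variable {H : Type*} [NormedAddCommGroup H] [InnerProductSpace ℂ H]

theorem mem_adjoint_iff_inner_eq {g : Submodule ℂ (H × H)} {y w : H} :
    (y, w) ∈ g.adjoint ↔ ∀ a b, (a, b) ∈ g → inner ℂ b y = inner ℂ a w := by
  simp [sub_eq_zero]

theorem inner_eq_of_mem_adjoint {g : Submodule ℂ (H × H)} {p q : H × H} (hp : p ∈ g.adjoint)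
    (hq : q ∈ g) : inner ℂ q.2 p.1 = inner ℂ q.1 p.2 :=
  mem_adjoint_iff_inner_eq.1 hp _ _ hq

/-- The pair `(α e₊ + β e₋, i α e₊ - i β e₋)` of the graph of `S†`, where `S† e± = ± i e±`. -/
def defectPair (ep em : H) (α β : ℂ) : H × H :=
  (α • ep + β • em, (Complex.I * α) • ep - (Complex.I * β) • em)

/-- `S` is a closed, densely defined, symmetric operator whose deficiency subspaces are spanned by
the non-zero vectors `ep` and `em` of equal norm. -/
structure DefectOne (S : H →ₗ.[ℂ] H) (ep em : H) : Prop where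
  dense : Dense (S.domain : Set H)
  closed : S.IsClosed
  symm : S.graph ≤ S.graph.adjoint
  mem_pos : ∀ y, (y, Complex.I • y) ∈ S.graph.adjoint ↔ y ∈ Submodule.span ℂ {ep}
  mem_neg : ∀ y, (y, -Complex.I • y) ∈ S.graph.adjoint ↔ y ∈ Submodule.span ℂ {em}
  norm_eq : ‖ep‖ = ‖em‖
  ne_zero : ep ≠ 0

theorem adjoint_antitone {g g' : Submodule ℂ (H × H)} (h : g ≤ g') : g'.adjoint ≤ g.adjoint := by
  rintro ⟨y, w⟩ hy
  rw [mem_adjoint_iff_inner_eq] at hy ⊢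
  exact fun a b hab => hy a b (h hab)

theorem adjoint_snd_eq {S : H →ₗ.[ℂ] H} (hd : Dense (S.domain : Set H)) {y w w' : H}
    (h : (y, w) ∈ S.graph.adjoint) (h' : (y, w') ∈ S.graph.adjoint) : w = w' := by
  rw [mem_adjoint_iff_inner_eq] at h h'
  refine hd.eq_of_inner_right ℂ fun v hv => ?_
  rw [← h v (S ⟨v, hv⟩) (S.mem_graph ⟨v, hv⟩), ← h' v (S ⟨v, hv⟩) (S.mem_graph ⟨v, hv⟩)]

theorem isSelfAdjoint_iff_graph [CompleteSpace H] {A : H →ₗ.[ℂ] H}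
    (hd : Dense (A.domain : Set H)) : IsSelfAdjoint A ↔ A.graph.adjoint = A.graph := by
  rw [LinearPMap.isSelfAdjoint_def, ← LinearPMap.adjoint_graph_eq_graph_adjoint hd]
  exact ⟨fun h => by rw [h], LinearPMap.eq_of_eq_graph⟩

/-- A self-adjoint operator has no proper self-adjoint extension. -/
theorem eq_of_le_of_isSelfAdjoint [CompleteSpace H] {A B : H →ₗ.[ℂ] H} (hA : IsSelfAdjoint A)
    (hB : IsSelfAdjoint B) (h : A ≤ B) : A = B := by
  refine LinearPMap.eq_of_eq_graph (le_antisymm (LinearPMap.le_graph_of_le h) ?_)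
  rw [← (isSelfAdjoint_iff_graph hA.dense_domain).1 hA,
    ← (isSelfAdjoint_iff_graph hB.dense_domain).1 hB]
  exact adjoint_antitone (LinearPMap.le_graph_of_le h)

namespace DefectOne

variable {S : H →ₗ.[ℂ] H} {ep em : H} (h : DefectOne S ep em)
include h

theorem ep_mem : (ep, Complex.I • ep) ∈ S.graph.adjoint :=
  (h.mem_pos ep).2 (Submodule.mem_span_singleton_self ep)

theorem em_mem : (em, -Complex.I • em) ∈ S.graph.adjoint :=
  (h.mem_neg em).2 (Submodule.mem_span_singleton_self em)

theorem defectPair_mem (α β : ℂ) : defectPair ep em α β ∈ S.graph.adjoint := by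
  have := add_mem (Submodule.smul_mem _ α h.ep_mem) (Submodule.smul_mem _ β h.em_mem)
  convert this using 1
  simp only [defectPair, Prod.smul_mk, Prod.mk_add_mk, smul_smul, Prod.mk.injEq, true_and]
  module

/-- The range of `S + i` is closed, since `‖(S + i) x‖² = ‖S x‖² + ‖x‖²`. -/
theorem isClosed_range_add_I [CompleteSpace H] :
    IsClosed ((S.graph.map (LinearMap.snd ℂ H H + Complex.I • LinearMap.fst ℂ H H) :
      Submodule ℂ H) : Set H) := by
  let T : (H × H) →L[ℂ] H :=
    ContinuousLinearMap.snd ℂ H H + Complex.I • ContinuousLinearMap.fst ℂ H H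
  have hT : ∀ p ∈ S.graph, ‖p‖ ≤ ‖T p‖ := by
    rintro ⟨x, y⟩ hp
    have hs : inner ℂ y x = inner ℂ x y := mem_adjoint_iff_inner_eq.1 (h.symm hp) x y hp
    have hn : ‖T (x, y)‖ ^ 2 = ‖y‖ ^ 2 + ‖x‖ ^ 2 := by
      have hre : RCLike.re (inner ℂ y (Complex.I • x)) = 0 := by
        have h2 : inner ℂ y x = starRingEnd ℂ (inner ℂ y x) := by
          rw [inner_conj_symm, hs]
        have h3 : (inner ℂ y x).im = 0 := Complex.conj_eq_iff_im.1 h2.symm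
        rw [inner_smul_right]
        simp [h3]
      have := @norm_add_sq ℂ H _ _ _ y (Complex.I • x)
      rw [hre, norm_smul, Complex.norm_I] at this
      simpa [T] using this
    have h1 : ‖x‖ ≤ ‖T (x, y)‖ := abs_le_of_sq_le_sq' (by nlinarith [sq_nonneg ‖y‖])
      (norm_nonneg _) |>.2
    have h2 : ‖y‖ ≤ ‖T (x, y)‖ := abs_le_of_sq_le_sq' (by nlinarith [sq_nonneg ‖x‖])
      (norm_nonneg _) |>.2
    exact max_le h1 h2
  have hc : IsComplete (S.graph : Set (H × H)) := IsClosed.isComplete h.closed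
  have hanti : AntilipschitzWith 1 (T.toLinearMap.domRestrict S.graph) := by
    refine AddMonoidHomClass.antilipschitz_of_bound (T.toLinearMap.domRestrict S.graph) ?_
    intro p
    simpa using hT p.1 p.2
  have hcont : UniformContinuous (T.toLinearMap.domRestrict S.graph) := by
    exact T.uniformContinuous.comp uniformContinuous_subtype_val
  have : CompleteSpace S.graph := hc.completeSpace_coe
  have hr := hanti.isClosed_range hcont
  convert hr using 1
  ext z
  simp [T]

/-- Von Neumann's formula: the graph of `S†` is the graph of `S` plus the deficiency subspaces. -/
theorem exists_of_mem_adjoint [CompleteSpace H] {p : H × H} (hp : p ∈ S.graph.adjoint) :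
    ∃ q ∈ S.graph, ∃ α β : ℂ, p = q + defectPair ep em α β := by
  obtain ⟨y, w⟩ := p
  set K := S.graph.map (LinearMap.snd ℂ H H + Complex.I • LinearMap.fst ℂ H H)
  have hKc : IsClosed (K : Set H) := h.isClosed_range_add_I
  have : CompleteSpace K := hKc.completeSpace_coe
  obtain ⟨k, hk, n, hn, hkn⟩ := K.exists_add_mem_mem_orthogonal (w + Complex.I • y)
  obtain ⟨⟨x, x'⟩, hx, rfl⟩ := hk
  simp only [LinearMap.add_apply, LinearMap.snd_apply, LinearMap.smul_apply, LinearMap.fst_apply]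
    at hkn
  have hn1 : (n, Complex.I • n) ∈ S.graph.adjoint := by
    rw [mem_adjoint_iff_inner_eq]
    intro a b hab
    have := (K.mem_orthogonal n).1 hn (b + Complex.I • a) ⟨(a, b), hab, by simp⟩
    rw [inner_add_left, inner_smul_left, Complex.conj_I] at this
    rw [inner_smul_right]
    linear_combination this
  obtain ⟨α, hα⟩ := Submodule.mem_span_singleton.1 ((h.mem_pos n).1 hn1)
  -- `n` lies in the range of `S† + i`, because `(S† + i) n = 2 i n`
  have hm : (y - x - (-(Complex.I / 2)) • n, -Complex.I • (y - x - (-(Complex.I / 2)) • n)) ∈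
      S.graph.adjoint := by
    have := sub_mem (sub_mem hp (h.symm hx)) (Submodule.smul_mem _ (-(Complex.I / 2)) hn1)
    convert this using 1
    simp only [Prod.smul_mk, Prod.mk_sub_mk, Prod.mk.injEq, true_and]
    have hw : w = x' + Complex.I • x + n - Complex.I • y := by rw [← hkn]; abel
    rw [hw]
    have : (Complex.I * Complex.I) = -1 := Complex.I_mul_I
    match_scalars <;> first | ring1 | linear_combination (-1) * this
  obtain ⟨β, hβ⟩ := Submodule.mem_span_singleton.1 ((h.mem_neg _).1 hm)
  refine ⟨(x, x'), hx, -(Complex.I / 2) * α, β, ?_⟩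
  have hy : y = x + (defectPair ep em (-(Complex.I / 2) * α) β).1 := by
    simp only [defectPair]
    rw [hβ, mul_smul, hα]; module
  have hmem := add_mem (h.symm hx) (h.defectPair_mem (-(Complex.I / 2) * α) β)
  have hw := adjoint_snd_eq (y := y) (w := w)
    (w' := x' + (defectPair ep em (-(Complex.I / 2) * α) β).2) h.dense hp (by
      convert hmem using 1
      exact Prod.ext hy rfl)
  exact Prod.ext hy hw

/-- An element of the graph of `S†` lies in that of `S` if its boundary form with `e₊` and `e₋`
vanishes. -/
theorem mem_graph_of_inner [CompleteSpace H] {y w : H} (hy : (y, w) ∈ S.graph.adjoint)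
    (h1 : inner ℂ w ep = inner ℂ y (Complex.I • ep))
    (h2 : inner ℂ w em = inner ℂ y (-Complex.I • em)) : (y, w) ∈ S.graph := by
  obtain ⟨⟨x, x'⟩, hx, α, β, hq⟩ := h.exists_of_mem_adjoint hy
  obtain ⟨rfl, rfl⟩ := Prod.ext_iff.1 hq
  have e1 := mem_adjoint_iff_inner_eq.1 h.ep_mem x x' hx
  have e2 := mem_adjoint_iff_inner_eq.1 h.em_mem x x' hx
  have hem : em ≠ 0 := by rw [← norm_ne_zero_iff, ← h.norm_eq, norm_ne_zero_iff]; exact h.ne_zero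
  have n1 : (inner ℂ ep ep : ℂ) ≠ 0 := inner_self_ne_zero.2 h.ne_zero
  have n2 : (inner ℂ em em : ℂ) ≠ 0 := inner_self_ne_zero.2 hem
  simp only [defectPair, Prod.fst_add, Prod.snd_add, inner_add_left, inner_sub_left,
    inner_smul_left, inner_smul_right, map_mul, Complex.conj_I] at h1 h2 e1 e2
  have hI := Complex.I_ne_zero
  have ha : starRingEnd ℂ α * inner ℂ ep ep = 0 := by
    have : Complex.I * (2 * (starRingEnd ℂ α * inner ℂ ep ep)) = 0 := by
      linear_combination e1 - h1
    simpa [hI] using this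
  have hb : starRingEnd ℂ β * inner ℂ em em = 0 := by
    have : Complex.I * (2 * (starRingEnd ℂ β * inner ℂ em em)) = 0 := by
      linear_combination h2 - e2
    simpa [hI] using this
  have hα : α = 0 := by simpa [h.ne_zero] using ha
  have hβ : β = 0 := by simpa [hem] using hb
  simpa [defectPair, hα, hβ] using hx

/-- The deficiency subspaces are linearly independent modulo the domain of `S`. -/
theorem eq_zero_of_mem_domain {α β : ℂ} (hd : α • ep + β • em ∈ S.domain) : α = 0 ∧ β = 0 := by
  obtain ⟨w, hw⟩ := LinearPMap.mem_domain_iff.1 hd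
  obtain rfl : w = (defectPair ep em α β).2 :=
    adjoint_snd_eq h.dense (h.symm hw) (h.defectPair_mem α β)
  have e1 := mem_adjoint_iff_inner_eq.1 h.ep_mem _ _ hw
  have e2 := mem_adjoint_iff_inner_eq.1 h.em_mem _ _ hw
  have hem : em ≠ 0 := by rw [← norm_ne_zero_iff, ← h.norm_eq, norm_ne_zero_iff]; exact h.ne_zero
  simp only [defectPair, inner_add_left, inner_sub_left,
    inner_smul_left, inner_smul_right, map_mul, Complex.conj_I] at e1 e2
  have hI := Complex.I_ne_zero
  have ha : starRingEnd ℂ α * inner ℂ ep ep = 0 := by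
    have : Complex.I * (2 * (starRingEnd ℂ α * inner ℂ ep ep)) = 0 := by
      linear_combination -e1
    simpa [hI] using this
  have hb : starRingEnd ℂ β * inner ℂ em em = 0 := by
    have : Complex.I * (2 * (starRingEnd ℂ β * inner ℂ em em)) = 0 := by
      linear_combination e2
    simpa [hI] using this
  exact ⟨by simpa [h.ne_zero] using ha, by simpa [hem] using hb⟩

/-- The boundary form of two elements of the deficiency spaces. -/
theorem inner_defectPair_sub (α β γ δ : ℂ) :
    inner ℂ (defectPair ep em α β).2 (defectPair ep em γ δ).1 -
      inner ℂ (defectPair ep em α β).1 (defectPair ep em γ δ).2 =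
    -2 * Complex.I * (starRingEnd ℂ α * γ - starRingEnd ℂ β * δ) * (‖ep‖ ^ 2 : ℝ) := by
  have n1 : (inner ℂ ep ep : ℂ) = (‖ep‖ ^ 2 : ℝ) := by
    rw [inner_self_eq_norm_sq_to_K]; norm_cast
  have n2 : (inner ℂ em em : ℂ) = (‖ep‖ ^ 2 : ℝ) := by
    rw [inner_self_eq_norm_sq_to_K, h.norm_eq]; norm_cast
  simp only [defectPair, inner_add_left, inner_sub_left, inner_add_right, inner_sub_right,
    inner_smul_left, inner_smul_right, map_mul, Complex.conj_I, n1, n2]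
  ring

/-- The graph of the extension of `S` by `α e₊ + β e₋` is indeed a graph. -/
theorem graph_extension {α β : ℂ} (hα : α ≠ 0) :
    ((S.graph ⊔ Submodule.span ℂ {defectPair ep em α β}).toLinearPMap).graph =
      S.graph ⊔ Submodule.span ℂ {defectPair ep em α β} := by
  apply Submodule.toLinearPMap_graph_eq
  rintro p hp h0
  obtain ⟨⟨x, x'⟩, hx, r, hr, rfl⟩ := Submodule.mem_sup.1 hp
  obtain ⟨c, rfl⟩ := Submodule.mem_span_singleton.1 hr
  simp only [defectPair, Prod.smul_mk, Prod.mk_add_mk] at h0 ⊢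
  have hmem : (-c * α) • ep + (-c * β) • em ∈ S.domain := by
    have : (-c * α) • ep + (-c * β) • em = x := by
      rw [eq_comm, ← sub_eq_zero, ← h0]; module
    rw [this]
    exact LinearPMap.mem_domain_of_mem_graph hx
  have hc : c = 0 := by simpa [hα] using (h.eq_zero_of_mem_domain hmem).1
  subst hc
  simp only [zero_smul, add_zero] at h0 ⊢
  subst h0
  exact S.graph_fst_eq_zero_snd hx rfl

/-- The boundary form vanishes on a vector `α e₊ + β e₋` with `|α| = |β|`, and a second vector
`γ e₊ + δ e₋` whose boundary form with it vanishes is a multiple of it. -/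
theorem isSelfAdjoint_extension [CompleteSpace H] {α β : ℂ} (hα : ‖α‖ = 1) (hβ : ‖β‖ = 1) :
    IsSelfAdjoint (S.graph ⊔ Submodule.span ℂ {defectPair ep em α β}).toLinearPMap := by
  have hα0 : α ≠ 0 := norm_ne_zero_iff.1 (by rw [hα]; exact one_ne_zero)
  have hg := h.graph_extension (β := β) hα0
  have hle : S ≤ (S.graph ⊔ Submodule.span ℂ {defectPair ep em α β}).toLinearPMap := by
    rw [← LinearPMap.le_graph_iff, hg]
    exact le_sup_left
  have hc : starRingEnd ℂ α * α = starRingEnd ℂ β * β := by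
    rw [Complex.conj_mul', Complex.conj_mul', hα, hβ]
  rw [isSelfAdjoint_iff_graph (h.dense.mono hle.1), hg]
  apply le_antisymm
  · intro p hp
    have hp' := adjoint_antitone (le_sup_left) hp
    obtain ⟨q, hq, γ, δ, rfl⟩ := h.exists_of_mem_adjoint hp'
    have hS : ∀ r ∈ S.graph ⊔ Submodule.span ℂ {defectPair ep em α β}, ∀ q ∈ S.graph,
        inner ℂ r.2 q.1 = inner ℂ r.1 q.2 := by
      intro r hr q hq
      obtain ⟨s, hs, t, ht, rfl⟩ := Submodule.mem_sup.1 hr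
      obtain ⟨c, rfl⟩ := Submodule.mem_span_singleton.1 ht
      have h1 := inner_eq_of_mem_adjoint (h.symm hq) hs
      have h2 := inner_eq_of_mem_adjoint (h.defectPair_mem α β) hq
      have h3 : inner ℂ (defectPair ep em α β).2 q.1 = inner ℂ (defectPair ep em α β).1 q.2 := by
        rw [← inner_conj_symm, ← h2, inner_conj_symm]
      simp only [Prod.fst_add, Prod.snd_add, Prod.smul_fst, Prod.smul_snd, inner_add_left,
        inner_smul_left, h1, h3]
    have hm : defectPair ep em α β ∈ S.graph ⊔ Submodule.span ℂ {defectPair ep em α β} :=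
      Submodule.mem_sup_right (Submodule.mem_span_singleton_self _)
    have h1 := inner_eq_of_mem_adjoint hp hm
    have h2 := hS _ hm q hq
    have h3 := h.inner_defectPair_sub α β γ δ
    simp only [Prod.fst_add, Prod.snd_add, inner_add_right] at h1
    have h4 : starRingEnd ℂ α * γ = starRingEnd ℂ β * δ := by
      have h5 : -2 * Complex.I * (starRingEnd ℂ α * γ - starRingEnd ℂ β * δ) *
          (‖ep‖ ^ 2 : ℝ) = 0 := by rw [← h3]; linear_combination h1 - h2
      simpa [sub_eq_zero, h.ne_zero] using h5
    have hα1 : starRingEnd ℂ α * α = 1 := by rw [Complex.conj_mul', hα]; norm_num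
    have hβ1 : starRingEnd ℂ β * β = 1 := by rw [Complex.conj_mul', hβ]; norm_num
    refine add_mem (Submodule.mem_sup_left hq) (Submodule.mem_sup_right
      (Submodule.mem_span_singleton.2 ⟨starRingEnd ℂ α * γ, ?_⟩))
    have e1 : starRingEnd ℂ α * γ * α = γ := by linear_combination γ * hα1
    have e2 : starRingEnd ℂ α * γ * β = δ := by linear_combination β * h4 + δ * hβ1
    simp only [defectPair, Prod.smul_mk, smul_add, smul_sub, smul_smul, Prod.mk.injEq]
    constructor
    · rw [e1, e2]
    · rw [mul_left_comm, mul_left_comm (_ * _), e1, e2]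
  · intro p hp
    obtain ⟨q, hq, t, ht, rfl⟩ := Submodule.mem_sup.1 hp
    obtain ⟨c, rfl⟩ := Submodule.mem_span_singleton.1 ht
    rw [← Prod.mk.eta (p := q + _), mem_adjoint_iff_inner_eq]
    intro a b hab
    obtain ⟨s, hs, t, ht, hst⟩ := Submodule.mem_sup.1 hab
    obtain ⟨d, rfl⟩ := Submodule.mem_span_singleton.1 ht
    obtain ⟨rfl, rfl⟩ := Prod.ext_iff.1 hst
    have h1 := inner_eq_of_mem_adjoint (h.symm hq) hs
    have h2 := inner_eq_of_mem_adjoint (h.defectPair_mem α β) hq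
    have h3 : inner ℂ (defectPair ep em α β).2 q.1 = inner ℂ (defectPair ep em α β).1 q.2 := by
      rw [← inner_conj_symm, ← h2, inner_conj_symm]
    have h4 := inner_eq_of_mem_adjoint (h.defectPair_mem α β) hs
    have h5 := h.inner_defectPair_sub α β α β
    rw [hc, sub_self, mul_zero, zero_mul, sub_eq_zero] at h5
    simp only [Prod.fst_add, Prod.snd_add, Prod.smul_fst, Prod.smul_snd, inner_add_left,
      inner_add_right, inner_smul_left, inner_smul_right, h1, h3, h4, h5]

/-- Every self-adjoint extension of `S` contains a vector `α e₊ + β e₋` with `|α| = |β| = 1`. -/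
theorem exists_defectPair_mem [CompleteSpace H] {A : H →ₗ.[ℂ] H} (hA : IsSelfAdjoint A)
    (hle : S ≤ A) : ∃ α β : ℂ, ‖α‖ = 1 ∧ ‖β‖ = 1 ∧ defectPair ep em α β ∈ A.graph := by
  have hAg := (isSelfAdjoint_iff_graph hA.dense_domain).1 hA
  have hSA := LinearPMap.le_graph_of_le hle
  have hAS : A.graph ≤ S.graph.adjoint := by
    rw [← hAg]; exact adjoint_antitone hSA
  obtain ⟨p, hpA, hpS⟩ : ∃ p ∈ A.graph, p ∉ S.graph := by
    by_contra! hcon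
    have hEq : S.graph = A.graph := le_antisymm hSA hcon
    have := h.ep_mem
    rw [hEq, hAg, ← hEq] at this
    have := h.eq_zero_of_mem_domain (α := 1) (β := 0)
      (by simpa using LinearPMap.mem_domain_of_mem_graph this)
    exact one_ne_zero this.1
  obtain ⟨q, hq, γ, δ, rfl⟩ := h.exists_of_mem_adjoint (hAS hpA)
  have hd : defectPair ep em γ δ ∈ A.graph := by
    simpa using sub_mem hpA (hSA hq)
  have hsym : inner ℂ (defectPair ep em γ δ).2 (defectPair ep em γ δ).1 =
      inner ℂ (defectPair ep em γ δ).1 (defectPair ep em γ δ).2 := by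
    have hd' := hd
    rw [← hAg] at hd'
    exact mem_adjoint_iff_inner_eq.1 hd' _ _ hd
  have h1 := h.inner_defectPair_sub γ δ γ δ
  rw [hsym, sub_self, eq_comm] at h1
  have h2 : starRingEnd ℂ γ * γ = starRingEnd ℂ δ * δ := by
    simpa [h.ne_zero, sub_eq_zero] using h1
  have h3 : ‖γ‖ = ‖δ‖ := by
    rw [Complex.conj_mul', Complex.conj_mul'] at h2
    have : ‖γ‖ ^ 2 = ‖δ‖ ^ 2 := by exact_mod_cast h2
    exact (sq_eq_sq₀ (norm_nonneg _) (norm_nonneg _)).1 this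
  have hγ : ‖γ‖ ≠ 0 := by
    intro h0
    have hγ0 : γ = 0 := norm_eq_zero.1 h0
    have hδ0 : δ = 0 := norm_eq_zero.1 (h3 ▸ h0)
    apply hpS
    simpa [hγ0, hδ0, defectPair] using hq
  refine ⟨(‖γ‖ : ℂ)⁻¹ * γ, (‖γ‖ : ℂ)⁻¹ * δ, ?_, ?_, ?_⟩
  · simp [hγ]
  · rw [norm_mul, ← h3]; simp [hγ]
  · convert Submodule.smul_mem _ ((‖γ‖ : ℂ)⁻¹) hd using 1
    simp only [defectPair, Prod.smul_mk, smul_add, smul_sub, smul_smul, mul_left_comm]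

end DefectOne

end Defect

/-! ### Green's formula for `i x (d/dx) x` -/

/-- `G` represents the pair `(y, w)`, which formally means `w = i x (x y)'`: `y = G / x` and
`w = i x G'` almost everywhere, where `G` is differentiable away from the origin. -/
structure IsRep (y w : L2R) (G G' : ℝ → ℂ) : Prop where
  deriv : ∀ x, x ≠ 0 → HasDerivAt G (G' x) x
  fst : y =ᵐ[volume] fun x => (x : ℂ)⁻¹ * G x
  snd : w =ᵐ[volume] fun x => Complex.I * (x * G' x)

theorem ae_ne_zero : ∀ᵐ x : ℝ, x ≠ 0 := by
  simp [ae_iff]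

/-- The boundary terms at the origin vanish, and those at `+∞` and `-∞` cancel. -/
theorem IsRep.inner_eq {y w y₂ w₂ : L2R} {G G' G₂ G₂' : ℝ → ℂ} {l : ℂ} (h : IsRep y w G G')
    (h₂ : IsRep y₂ w₂ G₂ G₂')
    (h0 : Tendsto (fun x => starRingEnd ℂ (G x) * G₂ x) (𝓝[≠] 0) (𝓝 0))
    (hl : Tendsto (fun x => starRingEnd ℂ (G x) * G₂ x) (cocompact ℝ) (𝓝 l)) :
    inner ℂ w y₂ = inner ℂ y w₂ := by
  have i1 : Integrable (fun x => inner ℂ (w x) (y₂ x)) := L2.integrable_inner w y₂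
  have i2 : Integrable (fun x => inner ℂ (y x) (w₂ x)) := L2.integrable_inner y w₂
  have e : (fun x => Complex.I * (inner ℂ (w x) (y₂ x) - inner ℂ (y x) (w₂ x))) =ᵐ[volume]
      fun x => starRingEnd ℂ (G' x) * G₂ x + starRingEnd ℂ (G x) * G₂' x := by
    filter_upwards [h.fst, h.snd, h₂.fst, h₂.snd, ae_ne_zero] with x a1 a2 a3 a4 hx
    have hx' : (x : ℂ) ≠ 0 := by exact_mod_cast hx
    simp only [RCLike.inner_apply, a1, a2, a3, a4, map_mul, map_inv₀, Complex.conj_ofReal,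
      Complex.conj_I]
    field_simp
    linear_combination (-starRingEnd ℂ (G' x) * G₂ x - starRingEnd ℂ (G x) * G₂' x) *
      Complex.I_sq
  have hint : Integrable
      (fun x => starRingEnd ℂ (G' x) * G₂ x + starRingEnd ℂ (G x) * G₂' x) :=
    ((i1.sub i2).const_mul Complex.I).congr e
  have hd : ∀ x, x ≠ 0 → HasDerivAt (fun x => starRingEnd ℂ (G x)) (starRingEnd ℂ (G' x)) x :=
    fun x hx => (Complex.conjCLE.toContinuousLinearMap.hasFDerivAt).comp_hasDerivAt x (h.deriv x hx)
  have r1 : ∫ x in Set.Ioi (0 : ℝ),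
      (starRingEnd ℂ (G' x) * G₂ x + starRingEnd ℂ (G x) * G₂' x) = l - 0 := by
    refine integral_Ioi_deriv_mul_eq_sub (fun x hx => hd x (ne_of_gt hx))
      (fun x hx => h₂.deriv x (ne_of_gt hx)) hint.integrableOn ?_ ?_
    · exact h0.mono_left (nhdsWithin_mono _ fun x hx => ne_of_gt hx)
    · exact hl.mono_left (by rw [cocompact_eq_atBot_atTop]; exact le_sup_right)
  have r2 : ∫ x in Set.Iic (0 : ℝ),
      (starRingEnd ℂ (G' x) * G₂ x + starRingEnd ℂ (G x) * G₂' x) = 0 - l := by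
    refine integral_Iic_deriv_mul_eq_sub (fun x hx => hd x (ne_of_lt hx))
      (fun x hx => h₂.deriv x (ne_of_lt hx)) hint.integrableOn ?_ ?_
    · exact h0.mono_left (nhdsWithin_mono _ fun x hx => ne_of_lt hx)
    · exact hl.mono_left (by rw [cocompact_eq_atBot_atTop]; exact le_sup_left)
  have r := intervalIntegral.integral_Iic_add_Ioi (b := (0 : ℝ)) hint.integrableOn
    hint.integrableOn
  rw [r1, r2, ← integral_congr_ae e, integral_const_mul, integral_sub i1 i2] at r
  have r' : Complex.I * (inner ℂ w y₂ - inner ℂ y w₂) = 0 := by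
    rw [L2.inner_def, L2.inner_def, ← r]
    ring
  simpa [sub_eq_zero] using r'

/-- Green's formula without boundary terms. -/
theorem IsRep.inner_eq_of_tendsto_zero {y w y₂ w₂ : L2R} {G G' G₂ G₂' : ℝ → ℂ}
    (h : IsRep y w G G') (h₂ : IsRep y₂ w₂ G₂ G₂') (h0 : Tendsto G (𝓝[≠] 0) (𝓝 0))
    (hl : Tendsto G (cocompact ℝ) (𝓝 0)) {C : ℝ} (hC : ∀ x, ‖G₂ x‖ ≤ C) :
    inner ℂ w y₂ = inner ℂ y w₂ := by
  have key : ∀ l : Filter ℝ, Tendsto G l (𝓝 0) →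
      Tendsto (fun x => starRingEnd ℂ (G x) * G₂ x) l (𝓝 0) := by
    intro l hl
    have h1 : Tendsto (fun x => starRingEnd ℂ (G x)) l (𝓝 0) := by
      simpa [Function.comp_def] using (Complex.continuous_conj.tendsto 0).comp hl
    exact h1.zero_mul_isBoundedUnder_le (isBoundedUnder_of ⟨C, hC⟩)
  exact h.inner_eq h₂ (key _ h0) (key _ hl)

theorem hasDerivAt_phase (θ : ℝ) {x : ℝ} (hx : x ≠ 0) : HasDerivAt (phase θ) 0 x := by
  refine (hasDerivAt_const x (phase θ x)).congr_of_eventuallyEq ?_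
  rcases lt_or_gt_of_ne hx with h | h
  · filter_upwards [Iio_mem_nhds h] with t ht
    simp only [phase]
    rw [Real.sign_of_neg h, Real.sign_of_neg ht]
  · filter_upwards [Ioi_mem_nhds h] with t ht
    simp only [phase]
    rw [Real.sign_of_pos h, Real.sign_of_pos ht]

theorem coeFn_unitaryL (θ : ℝ) (f : L2R) :
    unitaryL θ f =ᵐ[volume] fun x => phase θ x * f x := mulPhase_coeFn θ f

theorem IsRep.unitaryL {y w : L2R} {G G' : ℝ → ℂ} (h : IsRep y w G G') (θ : ℝ) :
    IsRep (unitaryL θ y) (unitaryL θ w) (fun x => phase θ x * G x)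
      (fun x => phase θ x * G' x) where
  deriv x hx := by
    have := (hasDerivAt_phase θ hx).fun_mul (h.deriv x hx)
    rwa [zero_mul, zero_add] at this
  fst := by
    filter_upwards [coeFn_unitaryL θ y, h.fst] with x h1 h2
    rw [h1, h2]; ring
  snd := by
    filter_upwards [coeFn_unitaryL θ w, h.snd] with x h1 h2
    rw [h1, h2]; ring

theorem coeFn_schwartzIncl (f : 𝓢(ℝ, ℂ)) : schwartzIncl f =ᵐ[volume] f :=
  f.coeFn_toLp 2 volume

theorem isRep_schwartz (f : 𝓢(ℝ, ℂ)) :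
    IsRep (schwartzIncl f) (schwartzIncl (schwartzOp f)) (mulX f) (deriv (mulX f)) where
  deriv x _ := (mulX f).hasDerivAt x
  fst := by
    filter_upwards [coeFn_schwartzIncl f, ae_ne_zero] with x h1 hx
    have hx' : (x : ℂ) ≠ 0 := by exact_mod_cast hx
    rw [h1, mulX_apply]
    field_simp
  snd := by
    filter_upwards [coeFn_schwartzIncl (schwartzOp f)] with x h1
    have h : (mulX f : ℝ → ℂ) = fun y : ℝ => (y : ℂ) * f y := funext (mulX_apply f)
    rw [h1, schwartzOp_apply, h]

theorem tendsto_mulX_zero (f : 𝓢(ℝ, ℂ)) : Tendsto (mulX f) (𝓝[≠] 0) (𝓝 0) := by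
  have := ((mulX f).continuous.tendsto 0).mono_left (nhdsWithin_le_nhds (s := {0}ᶜ))
  simpa [mulX_apply] using this

/-- A pair represented by a bounded function belongs to the graph of the adjoint of `Π` on the
Schwartz space: for Schwartz `f` the function `x f` vanishes at the origin and at infinity. -/
theorem IsRep.inner_schwartz_eq {y w : L2R} {G G' : ℝ → ℂ} (h : IsRep y w G G') {C : ℝ}
    (hC : ∀ x, ‖G x‖ ≤ C) (f : 𝓢(ℝ, ℂ)) :
    inner ℂ (schwartzIncl (schwartzOp f)) y = inner ℂ (schwartzIncl f) w :=
  (isRep_schwartz f).inner_eq_of_tendsto_zero h (tendsto_mulX_zero f)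
    (mulX f).tendsto_cocompact hC

theorem mem_graph_opSchwartz {p : L2R × L2R} :
    p ∈ opSchwartz.graph ↔ ∃ f, (schwartzIncl f, schwartzIncl (schwartzOp f)) = p := by
  rw [LinearPMap.mem_graph_iff']
  constructor
  · rintro ⟨⟨_, f, rfl⟩, rfl⟩
    refine ⟨f, ?_⟩
    congr 1
    change _ = schwartzIncl (schwartzOp ((LinearEquiv.ofInjective schwartzIncl
      schwartzIncl_injective).symm (LinearEquiv.ofInjective schwartzIncl
        schwartzIncl_injective f)))
    rw [LinearEquiv.symm_apply_apply]
  · rintro ⟨f, rfl⟩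
    refine ⟨⟨schwartzIncl f, f, rfl⟩, ?_⟩
    congr 1
    change schwartzIncl (schwartzOp ((LinearEquiv.ofInjective schwartzIncl
      schwartzIncl_injective).symm (LinearEquiv.ofInjective schwartzIncl
        schwartzIncl_injective f))) = _
    rw [LinearEquiv.symm_apply_apply]

theorem dense_opSchwartz_domain : Dense (opSchwartz.domain : Set L2R) := by
  have := SchwartzMap.denseRange_toLpCLM (E := ℝ) (F := ℂ) (p := 2) (μ := volume)
    ENNReal.ofNat_ne_top
  exact this

theorem mem_adjoint_opSchwartz_iff {y w : L2R} :
    (y, w) ∈ opSchwartz.graph.adjoint ↔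
      ∀ f, inner ℂ (schwartzIncl (schwartzOp f)) y = inner ℂ (schwartzIncl f) w := by
  rw [mem_adjoint_iff_inner_eq]
  constructor
  · exact fun h f => h _ _ (mem_graph_opSchwartz.2 ⟨f, rfl⟩)
  · intro h a b hab
    obtain ⟨f, hf⟩ := mem_graph_opSchwartz.1 hab
    obtain ⟨rfl, rfl⟩ := Prod.ext_iff.1 hf
    exact h f

theorem schwartzMap_bounded (f : 𝓢(ℝ, ℂ)) : ∃ C : ℝ, ∀ x, ‖f x‖ ≤ C :=
  ⟨_, fun x => SchwartzMap.norm_le_seminorm ℂ f x⟩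

/-- Schwartz functions with a jump of the phase at the origin are in the domain of `Π†`. -/
theorem unitaryL_schwartz_mem (θ : ℝ) (f : 𝓢(ℝ, ℂ)) :
    (unitaryL θ (schwartzIncl f), unitaryL θ (schwartzIncl (schwartzOp f))) ∈
      opSchwartz.graph.adjoint := by
  rw [mem_adjoint_opSchwartz_iff]
  obtain ⟨C, hC⟩ := schwartzMap_bounded (mulX f)
  refine ((isRep_schwartz f).unitaryL θ).inner_schwartz_eq (C := C) fun x => ?_
  rw [norm_mul, norm_phase, one_mul]
  exact hC x

theorem phase_zero (x : ℝ) : phase 0 x = 1 := by simp [phase]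

theorem unitaryL_zero_apply (f : L2R) : unitaryL 0 f = f := by
  apply Lp.ext
  filter_upwards [coeFn_unitaryL 0 f] with x h
  rw [h, phase_zero, one_mul]

theorem opSchwartz_graph_le_adjoint : opSchwartz.graph ≤ opSchwartz.graph.adjoint := by
  intro p hp
  obtain ⟨f, rfl⟩ := mem_graph_opSchwartz.1 hp
  simpa [unitaryL_zero_apply] using unitaryL_schwartz_mem 0 f

theorem isClosable_opSchwartz : opSchwartz.IsClosable := by
  refine (LinearPMap.adjoint_isClosed dense_opSchwartz_domain).isClosable.leIsClosable ?_
  rw [← LinearPMap.le_graph_iff,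
    LinearPMap.adjoint_graph_eq_graph_adjoint dense_opSchwartz_domain]
  exact opSchwartz_graph_le_adjoint

theorem opPi_graph : opPi.graph = opSchwartz.graph.topologicalClosure :=
  isClosable_opSchwartz.graph_closure_eq_closure_graph.symm

theorem isClosed_adjoint {H : Type*} [NormedAddCommGroup H] [InnerProductSpace ℂ H]
    (g : Submodule ℂ (H × H)) : IsClosed (g.adjoint : Set (H × H)) := by
  have : (g.adjoint : Set (H × H)) =
      ⋂ q ∈ g, {p : H × H | inner ℂ q.2 p.1 = inner ℂ q.1 p.2} := by
    ext p
    simp only [SetLike.mem_coe, Set.mem_iInter, Set.mem_ofPred_eq]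
    exact ⟨fun hp q hq => inner_eq_of_mem_adjoint hp hq,
      fun h => mem_adjoint_iff_inner_eq.2 fun a b hab => h (a, b) hab⟩
  rw [this]
  refine isClosed_biInter fun q _ => isClosed_eq ?_ ?_ <;> fun_prop

theorem opPi_graph_adjoint : opPi.graph.adjoint = opSchwartz.graph.adjoint := by
  apply le_antisymm
  · exact adjoint_antitone (by rw [opPi_graph]; exact Submodule.le_topologicalClosure _)
  · rintro ⟨y, w⟩ hy
    rw [mem_adjoint_iff_inner_eq]
    intro a b hab
    rw [opPi_graph] at hab
    have hcl : IsClosed {q : L2R × L2R | inner ℂ q.2 y = inner ℂ q.1 w} :=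
      isClosed_eq (by fun_prop) (by fun_prop)
    exact closure_minimal (fun q hq => inner_eq_of_mem_adjoint hy hq) hcl hab

theorem opPi_graph_le_adjoint : opPi.graph ≤ opPi.graph.adjoint := by
  rw [opPi_graph_adjoint, opPi_graph]
  exact Submodule.topologicalClosure_minimal _ opSchwartz_graph_le_adjoint (isClosed_adjoint _)

theorem dense_opPi_domain : Dense (opPi.domain : Set L2R) :=
  dense_opSchwartz_domain.mono (LinearPMap.le_closure _).1

/-! ### The functions `ζ_θ` -/

theorem coeFn_zeta (θ : ℝ) : zeta θ =ᵐ[volume] zetaFun θ := (memLp_zetaFun θ).coeFn_toLp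

theorem phase_add (θ φ x : ℝ) : phase (θ + φ) x = phase θ x * phase φ x := by
  rw [phase, phase, phase, ← Complex.exp_add]
  congr 1
  push_cast
  ring

theorem phase_of_pos (θ : ℝ) {x : ℝ} (hx : 0 < x) :
    phase θ x = Complex.cos (θ / 2 : ℝ) + Complex.sin (θ / 2 : ℝ) * Complex.I := by
  rw [phase, Real.sign_of_pos hx, one_mul, mul_comm, Complex.exp_mul_I]

theorem phase_of_neg (θ : ℝ) {x : ℝ} (hx : x < 0) :
    phase θ x = Complex.cos (θ / 2 : ℝ) - Complex.sin (θ / 2 : ℝ) * Complex.I := by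
  rw [phase, Real.sign_of_neg hx, mul_comm, neg_one_mul, Complex.ofReal_neg, Complex.exp_mul_I,
    Complex.cos_neg, Complex.sin_neg]
  ring

theorem phase_pi_of_pos {x : ℝ} (hx : 0 < x) : phase Real.pi x = Complex.I := by
  rw [phase_of_pos _ hx]; push_cast; simp

theorem phase_pi_of_neg {x : ℝ} (hx : x < 0) : phase Real.pi x = -Complex.I := by
  rw [phase_of_neg _ hx]; push_cast; simp

theorem unitaryL_zeta (θ φ : ℝ) : unitaryL θ (zeta φ) = zeta (φ + θ) := by
  apply Lp.ext
  filter_upwards [coeFn_unitaryL θ (zeta φ), coeFn_zeta φ, coeFn_zeta (φ + θ)] with x h1 h2 h3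
  rw [h1, h2, h3, zetaFun, zetaFun, phase_add]
  ring

theorem hasDerivAt_exp_neg_inv_abs {x : ℝ} (hx : x ≠ 0) :
    HasDerivAt (fun x : ℝ => Real.exp (-|x|⁻¹))
      (Real.exp (-|x|⁻¹) * ((SignType.sign x : ℝ) / x ^ 2)) x := by
  have h := (((hasDerivAt_abs hx).fun_inv (abs_ne_zero.2 hx)).fun_neg).exp
  convert h using 1
  rw [sq_abs]
  ring

theorem isRep_zeta_zero :
    IsRep (zeta 0) (zeta Real.pi) (fun x => (Real.exp (-|x|⁻¹) : ℂ))
      (fun x => (Real.exp (-|x|⁻¹) * ((SignType.sign x : ℝ) / x ^ 2) : ℝ)) where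
  deriv x hx := (hasDerivAt_exp_neg_inv_abs hx).ofReal_comp
  fst := by
    filter_upwards [coeFn_zeta 0] with x h
    rw [h, zetaFun, phase_zero, one_div]
    push_cast
    ring
  snd := by
    filter_upwards [coeFn_zeta Real.pi, ae_ne_zero] with x h hx
    have hx' : (x : ℂ) ≠ 0 := by exact_mod_cast hx
    rw [h, zetaFun, one_div]
    rcases lt_or_gt_of_ne hx with h0 | h0
    · rw [phase_pi_of_neg h0, sign_neg h0]
      push_cast
      field_simp
      simp
    · rw [phase_pi_of_pos h0, sign_pos h0]
      push_cast
      field_simp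
      simp

theorem norm_exp_neg_inv_abs_le (x : ℝ) : ‖(Real.exp (-|x|⁻¹) : ℂ)‖ ≤ 1 := by
  rw [Complex.norm_real, Real.norm_of_nonneg (Real.exp_nonneg _), Real.exp_le_one_iff]
  simp

theorem tendsto_exp_neg_inv_abs_zero :
    Tendsto (fun x : ℝ => (Real.exp (-|x|⁻¹) : ℂ)) (𝓝[≠] 0) (𝓝 0) := by
  have h1 : Tendsto (fun x : ℝ => |x|⁻¹) (𝓝[≠] 0) atTop := by
    have := (tendsto_inv₀_nhdsNE_zero (α := ℝ))
    have := (tendsto_norm_cobounded_atTop).comp this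
    simpa [Function.comp_def] using this
  have h2 := Real.tendsto_exp_neg_atTop_nhds_zero.comp h1
  have h3 := (Complex.continuous_ofReal.tendsto 0).comp h2
  simpa [Function.comp_def] using h3

theorem tendsto_exp_neg_inv_abs_cocompact :
    Tendsto (fun x : ℝ => (Real.exp (-|x|⁻¹) : ℂ)) (cocompact ℝ) (𝓝 1) := by
  have h1 : Tendsto (fun x : ℝ => |x|⁻¹) (cocompact ℝ) (𝓝 0) :=
    tendsto_inv_atTop_zero.comp (tendsto_norm_cocompact_atTop (E := ℝ))
  have h2 : Tendsto (fun x : ℝ => Real.exp (-|x|⁻¹)) (cocompact ℝ) (𝓝 1) := by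
    simpa [Function.comp_def] using (Real.continuous_exp.tendsto _).comp h1.neg
  have h3 := (Complex.continuous_ofReal.tendsto 1).comp h2
  simpa [Function.comp_def] using h3

theorem zeta_mem_adjoint (θ : ℝ) : (zeta θ, zeta (θ + Real.pi)) ∈ opPi.graph.adjoint := by
  rw [opPi_graph_adjoint, mem_adjoint_opSchwartz_iff]
  have h := isRep_zeta_zero.unitaryL θ
  rw [unitaryL_zeta, unitaryL_zeta, zero_add, add_comm] at h
  refine h.inner_schwartz_eq (C := 1) fun x => ?_
  rw [norm_mul, norm_phase, one_mul]
  exact norm_exp_neg_inv_abs_le x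

theorem inner_zeta_pi_zeta_zero :
    inner ℂ (zeta Real.pi) (zeta 0) = inner ℂ (zeta 0) (zeta Real.pi) := by
  refine isRep_zeta_zero.inner_eq isRep_zeta_zero (l := 1) ?_ ?_
  · have := tendsto_exp_neg_inv_abs_zero.mul tendsto_exp_neg_inv_abs_zero
    simpa only [Complex.conj_ofReal, mul_zero] using this
  · have := tendsto_exp_neg_inv_abs_cocompact.mul tendsto_exp_neg_inv_abs_cocompact
    simpa only [Complex.conj_ofReal, mul_one] using this

theorem zeta_eq_cos_sin (θ : ℝ) :
    zeta θ = Complex.cos (θ / 2 : ℝ) • zeta 0 + Complex.sin (θ / 2 : ℝ) • zeta Real.pi := by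
  apply Lp.ext
  filter_upwards [coeFn_zeta θ, coeFn_zeta 0, coeFn_zeta Real.pi,
    Lp.coeFn_smul (Complex.cos (θ / 2 : ℝ)) (zeta 0),
    Lp.coeFn_smul (Complex.sin (θ / 2 : ℝ)) (zeta Real.pi),
    Lp.coeFn_add (Complex.cos (θ / 2 : ℝ) • zeta 0) (Complex.sin (θ / 2 : ℝ) • zeta Real.pi),
    ae_ne_zero] with x h1 h2 h3 h4 h5 h6 hx
  rw [h1, h6, Pi.add_apply, h4, h5, Pi.smul_apply, Pi.smul_apply, h2, h3, zetaFun, zetaFun,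
    zetaFun, phase_zero, smul_eq_mul, smul_eq_mul]
  rcases lt_or_gt_of_ne hx with h0 | h0
  · rw [phase_pi_of_neg h0, phase_of_neg θ h0]; ring
  · rw [phase_pi_of_pos h0, phase_of_pos θ h0]; ring

/-- The restriction of `ζ_0` to the positive half-line. -/
def ePos : L2R := (1 / 2 : ℂ) • (zeta 0 - Complex.I • zeta Real.pi)

/-- The restriction of `ζ_0` to the negative half-line. -/
def eNeg : L2R := (1 / 2 : ℂ) • (zeta 0 + Complex.I • zeta Real.pi)

theorem coeFn_ePos : ePos =ᵐ[volume] fun x => if 0 < x then (x⁻¹ * Real.exp (-x⁻¹) : ℂ) else 0 := by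
  filter_upwards [coeFn_zeta 0, coeFn_zeta Real.pi,
    Lp.coeFn_smul (1 / 2 : ℂ) (zeta 0 - Complex.I • zeta Real.pi),
    Lp.coeFn_sub (zeta 0) (Complex.I • zeta Real.pi), Lp.coeFn_smul Complex.I (zeta Real.pi),
    ae_ne_zero] with x h1 h2 h3 h4 h5 hx
  rw [ePos, h3, Pi.smul_apply, h4, Pi.sub_apply, h5, Pi.smul_apply, h1, h2, zetaFun, zetaFun,
    phase_zero, smul_eq_mul, smul_eq_mul, one_div |x|]
  rcases lt_or_gt_of_ne hx with h0 | h0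
  · rw [phase_pi_of_neg h0, if_neg h0.not_gt]
    linear_combination (1 / 2 * ((x⁻¹ * Real.exp (-|x|⁻¹) : ℝ) : ℂ)) * Complex.I_mul_I
  · rw [phase_pi_of_pos h0, if_pos h0, abs_of_pos h0]
    push_cast
    linear_combination (-1 / 2 * ((x : ℂ)⁻¹ * Complex.exp (-(x : ℂ)⁻¹))) * Complex.I_mul_I

theorem coeFn_eNeg : eNeg =ᵐ[volume] fun x => if x < 0 then (x⁻¹ * Real.exp (x⁻¹) : ℂ) else 0 := by
  filter_upwards [coeFn_zeta 0, coeFn_zeta Real.pi,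
    Lp.coeFn_smul (1 / 2 : ℂ) (zeta 0 + Complex.I • zeta Real.pi),
    Lp.coeFn_add (zeta 0) (Complex.I • zeta Real.pi), Lp.coeFn_smul Complex.I (zeta Real.pi),
    ae_ne_zero] with x h1 h2 h3 h4 h5 hx
  rw [eNeg, h3, Pi.smul_apply, h4, Pi.add_apply, h5, Pi.smul_apply, h1, h2, zetaFun, zetaFun,
    phase_zero, smul_eq_mul, smul_eq_mul, one_div |x|]
  rcases lt_or_gt_of_ne hx with h0 | h0
  · rw [phase_pi_of_neg h0, if_pos h0, abs_of_neg h0, inv_neg, neg_neg]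
    push_cast
    linear_combination (-1 / 2 * ((x : ℂ)⁻¹ * Complex.exp ((x : ℂ)⁻¹))) * Complex.I_mul_I
  · rw [phase_pi_of_pos h0, if_neg h0.not_gt]
    linear_combination (1 / 2 * ((x⁻¹ * Real.exp (-|x|⁻¹) : ℝ) : ℂ)) * Complex.I_mul_I

theorem zeta_eq (θ : ℝ) :
    zeta θ = Complex.exp ((θ / 2 : ℝ) * Complex.I) • ePos +
      Complex.exp (-(θ / 2 : ℝ) * Complex.I) • eNeg := by
  rw [zeta_eq_cos_sin θ, ePos, eNeg, Complex.exp_mul_I, Complex.exp_mul_I, Complex.cos_neg,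
    Complex.sin_neg]
  generalize ((θ / 2 : ℝ) : ℂ) = t
  have := Complex.I_mul_I
  match_scalars
  · ring
  · linear_combination (Complex.sin t) * this

theorem exp_half_add_pi (θ : ℝ) : Complex.exp (((θ + Real.pi) / 2 : ℝ) * Complex.I) =
    Complex.I * Complex.exp ((θ / 2 : ℝ) * Complex.I) := by
  nth_rw 2 [← Complex.exp_pi_div_two_mul_I]
  rw [← Complex.exp_add]
  congr 1; push_cast; ring

theorem exp_neg_half_add_pi (θ : ℝ) : Complex.exp (-((θ + Real.pi) / 2 : ℝ) * Complex.I) =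
    -Complex.I * Complex.exp (-(θ / 2 : ℝ) * Complex.I) := by
  rw [← Complex.exp_neg_pi_div_two_mul_I, ← Complex.exp_add]
  congr 1; push_cast; ring

theorem zeta_add_pi (θ : ℝ) :
    zeta (θ + Real.pi) = (Complex.I * Complex.exp ((θ / 2 : ℝ) * Complex.I)) • ePos -
      (Complex.I * Complex.exp (-(θ / 2 : ℝ) * Complex.I)) • eNeg := by
  rw [zeta_eq, exp_half_add_pi, exp_neg_half_add_pi, neg_mul, neg_smul, sub_eq_add_neg]

theorem zeta_pair_eq (θ : ℝ) :
    (zeta θ, zeta (θ + Real.pi)) = defectPair ePos eNeg (Complex.exp ((θ / 2 : ℝ) * Complex.I))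
      (Complex.exp (-(θ / 2 : ℝ) * Complex.I)) := by
  rw [defectPair, ← zeta_eq, ← zeta_add_pi]

theorem zeta_add_two_pi (θ : ℝ) : zeta (θ + 2 * Real.pi) = -zeta θ := by
  have h : θ + 2 * Real.pi = θ + Real.pi + Real.pi := by ring
  have hI := Complex.I_mul_I
  rw [h, zeta_add_pi, exp_half_add_pi, exp_neg_half_add_pi, zeta_eq θ]
  generalize Complex.exp ((θ / 2 : ℝ) * Complex.I) = p
  generalize Complex.exp (-(θ / 2 : ℝ) * Complex.I) = q
  match_scalars
  · linear_combination p * hI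
  · linear_combination q * hI

theorem ePos_mem_adjoint : (ePos, Complex.I • ePos) ∈ opPi.graph.adjoint := by
  have h := Submodule.smul_mem _ (1 / 2 : ℂ) (sub_mem (zeta_mem_adjoint 0)
    (Submodule.smul_mem _ Complex.I (zeta_mem_adjoint Real.pi)))
  rw [← two_mul, ← zero_add (2 * Real.pi), zeta_add_two_pi, zero_add] at h
  convert h using 1
  simp only [Prod.smul_mk, Prod.mk_sub_mk, ePos, Prod.mk.injEq, true_and]
  have := Complex.I_mul_I
  match_scalars <;> first | ring1 | linear_combination (-1 / 2) * this

theorem eNeg_mem_adjoint : (eNeg, -Complex.I • eNeg) ∈ opPi.graph.adjoint := by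
  have h := Submodule.smul_mem _ (1 / 2 : ℂ) (add_mem (zeta_mem_adjoint 0)
    (Submodule.smul_mem _ Complex.I (zeta_mem_adjoint Real.pi)))
  rw [← two_mul, ← zero_add (2 * Real.pi), zeta_add_two_pi, zero_add] at h
  convert h using 1
  simp only [Prod.smul_mk, Prod.mk_add_mk, eNeg, Prod.mk.injEq, true_and]
  have := Complex.I_mul_I
  match_scalars <;> first | ring1 | linear_combination (-1 / 2) * this

/-- Equality of norms amounts to the vanishing of the boundary form of `ζ_0` with itself. -/
theorem norm_ePos_eq_norm_eNeg : ‖ePos‖ = ‖eNeg‖ := by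
  have h1 : (inner ℂ (zeta 0) (zeta Real.pi)).im = 0 := by
    rw [← Complex.conj_eq_iff_im, inner_conj_symm, inner_zeta_pi_zeta_zero]
  have h2 : RCLike.re (inner ℂ (zeta 0) (Complex.I • zeta Real.pi)) = 0 := by
    rw [inner_smul_right]
    simp [h1]
  have h3 := norm_sub_sq (𝕜 := ℂ) (zeta 0) (Complex.I • zeta Real.pi)
  have h4 := norm_add_sq (𝕜 := ℂ) (zeta 0) (Complex.I • zeta Real.pi)
  rw [h2] at h3 h4
  have h5 : ‖zeta 0 - Complex.I • zeta Real.pi‖ = ‖zeta 0 + Complex.I • zeta Real.pi‖ := by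
    rw [← sq_eq_sq₀ (norm_nonneg _) (norm_nonneg _), h3, h4]
    ring
  rw [ePos, eNeg, norm_smul, norm_smul, h5]

theorem ePos_ne_zero : ePos ≠ 0 := by
  intro h
  have h1 : eNeg = 0 := by rw [← norm_eq_zero, ← norm_ePos_eq_norm_eNeg, h, norm_zero]
  have h2 : zeta 0 = 0 := by rw [zeta_eq, h, h1]; simp
  have h3 := (coeFn_zeta 0).symm.trans (h2 ▸ Lp.coeFn_zero ℂ 2 volume)
  have h4 : ∀ᵐ x : ℝ, False := by
    filter_upwards [h3, ae_ne_zero] with x hx h0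
    rw [zetaFun, phase_zero, Pi.zero_apply, mul_one, Complex.ofReal_eq_zero] at hx
    exact mul_ne_zero (inv_ne_zero h0) (Real.exp_ne_zero _) hx
  rw [eventually_false_iff_eq_bot, ae_eq_bot] at h4
  exact (NeZero.ne (volume : Measure ℝ)) h4

/-! ### The deficiency subspaces of `Π` -/

/-- A smooth function with compact support in an interval `U` and vanishing integral has a
primitive with compact support in `U`. -/
theorem exists_primitive_of_integral_eq_zero {U : Set ℝ} (hU : U.OrdConnected) {h : ℝ → ℝ}
    (hs : ContDiff ℝ ∞ h) {K : Set ℝ} (hK : IsCompact K) (hKn : K.Nonempty) (hKU : K ⊆ U)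
    (hz : ∀ x, x ∉ K → h x = 0) (hi : ∫ x, h x = 0) :
    ∃ χ : ℝ → ℝ, ContDiff ℝ ∞ χ ∧ HasCompactSupport χ ∧ tsupport χ ⊆ U ∧ deriv χ = h := by
  set a := sInf K
  set b := sSup K
  have ha : ∀ x ∈ K, a ≤ x := fun x hx => csInf_le hK.bddBelow hx
  have hb : ∀ x ∈ K, x ≤ b := fun x hx => le_csSup hK.bddAbove hx
  have hab : Set.Icc a b ⊆ U := hU.out (hKU (hK.sInf_mem hKn)) (hKU (hK.sSup_mem hKn))
  have hc : Continuous h := hs.continuous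
  have hd : ∀ x, HasDerivAt (fun x => ∫ t in a..x, h t) (h x) x :=
    fun x => intervalIntegral.integral_hasDerivAt_right (hc.intervalIntegrable _ _)
      (hc.stronglyMeasurableAtFilter _ _) hc.continuousAt
  have hderiv : deriv (fun x => ∫ t in a..x, h t) = h := funext fun x => (hd x).deriv
  have hsupp : ∀ x, x ∉ Set.Icc a b → ∫ t in a..x, h t = 0 := by
    intro x hx
    rcases lt_or_ge x a with hxa | hxa
    · rw [intervalIntegral.integral_symm, neg_eq_zero]
      rw [intervalIntegral.integral_of_le hxa.le, integral_Ioc_eq_integral_Ioo]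
      exact setIntegral_eq_zero_of_forall_eq_zero fun t ht =>
        hz t fun htK => (ha t htK).not_gt ht.2
    · have hxb : b < x := not_le.1 fun h' => hx ⟨hxa, h'⟩
      rw [intervalIntegral.integral_of_le hxa, ← integral_Icc_eq_integral_Ioc, ← hi]
      refine setIntegral_eq_integral_of_forall_compl_eq_zero fun t ht => hz t fun htK => ht ?_
      exact ⟨ha t htK, (hb t htK).trans hxb.le⟩
  refine ⟨fun x => ∫ t in a..x, h t, ?_, ?_, ?_, hderiv⟩
  · rw [contDiff_infty_iff_deriv, hderiv]
    exact ⟨fun x => (hd x).differentiableAt, hs⟩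
  · exact HasCompactSupport.intro isCompact_Icc hsupp
  · refine (closure_minimal (fun x hx => ?_) isClosed_Icc).trans hab
    by_contra hx'
    exact hx (hsupp x hx')

/-- The du Bois-Reymond lemma: a locally integrable function on an open interval with vanishing
distributional derivative is constant. -/
theorem exists_ae_eq_const_of_integral_deriv {U : Set ℝ} (hU : IsOpen U) (hUc : U.OrdConnected)
    (hUn : U.Nonempty) {v : ℝ → ℂ} (hv : LocallyIntegrableOn v U)
    (h : ∀ χ : ℝ → ℝ, ContDiff ℝ ∞ χ → HasCompactSupport χ → tsupport χ ⊆ U →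
      ∫ x, deriv χ x • v x = 0) : ∃ c : ℂ, ∀ᵐ x, x ∈ U → v x = c := by
  have hint : ∀ g : ℝ → ℝ, Continuous g → HasCompactSupport g → tsupport g ⊆ U →
      Integrable fun x => g x • v x := by
    intro g hg hgc hgU
    have h1 : IntegrableOn (fun x => g x • v x) (tsupport g) :=
      (hv.integrableOn_compact_subset hgU hgc).continuousOn_smul hg.continuousOn hgc
    refine (integrableOn_iff_integrable_of_support_subset ?_).1 h1
    intro x hx
    by_contra hx'
    exact hx (by simp [image_eq_zero_of_notMem_tsupport hx'])
  obtain ⟨p, hp⟩ := hUn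
  obtain ⟨ε, hε, hεU⟩ := Metric.nhds_basis_closedBall.mem_iff.1 (hU.mem_nhds hp)
  -- subtracting `(∫ g) ρ` from a test function `g` makes its integral vanish
  let f : ContDiffBump p := ⟨ε / 2, ε, by positivity, by linarith⟩
  set ρ := f.normed volume
  have hρs : ContDiff ℝ ∞ ρ := f.contDiff_normed
  have hρc : HasCompactSupport ρ := f.hasCompactSupport_normed
  have hρt : tsupport ρ = Metric.closedBall p ε := f.tsupport_normed_eq
  have hρU : tsupport ρ ⊆ U := by rw [hρt]; exact hεU
  have hρ1 : ∫ x, ρ x = 1 := f.integral_normed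
  refine ⟨∫ x, ρ x • v x, ?_⟩
  have := hU.ae_eq_zero_of_integral_contDiff_smul_eq_zero (μ := volume)
    (f := fun x => v x - ∫ x, ρ x • v x)
    (hv.sub (locallyIntegrableOn_const _)) ?_
  · filter_upwards [this] with x hx hxU
    exact sub_eq_zero.1 (hx hxU)
  intro g hg hgc hgU
  obtain ⟨χ, hχ, hχc, hχU, hχd⟩ := exists_primitive_of_integral_eq_zero hUc
    (h := fun x => g x - (∫ x, g x) * ρ x) (hg.sub (contDiff_const.mul hρs))
    (K := tsupport g ∪ tsupport ρ) (hgc.isCompact.union hρc.isCompact)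
    ⟨p, Or.inr (by rw [hρt]; exact Metric.mem_closedBall_self hε.le)⟩
    (Set.union_subset hgU hρU)
    (fun x hx => by
      rw [Set.mem_union, not_or] at hx
      simp [image_eq_zero_of_notMem_tsupport hx.1, image_eq_zero_of_notMem_tsupport hx.2])
    (by
      rw [integral_sub (hg.continuous.integrable_of_hasCompactSupport hgc)
        ((hρs.continuous.integrable_of_hasCompactSupport hρc).const_mul _), integral_const_mul,
        hρ1, mul_one, sub_self])
  have h0 := h χ hχ hχc hχU
  rw [hχd] at h0
  have hg1 := hint g hg.continuous hgc hgU
  have hρ2 := hint ρ hρs.continuous hρc hρU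
  simp only [sub_smul, mul_smul] at h0
  rw [integral_sub hg1 (hρ2.fun_smul _), integral_smul] at h0
  simp only [smul_sub]
  rw [integral_sub hg1 ((hg.continuous.integrable_of_hasCompactSupport hgc).smul_const _),
    integral_smul_const]
  exact h0

theorem contDiff_mul_of_tsupport {χ g : ℝ → ℂ} (hχ : ContDiff ℝ ∞ χ)
    (hg : ∀ x ∈ tsupport χ, ContDiffAt ℝ ∞ g x) : ContDiff ℝ ∞ fun x => χ x * g x := by
  rw [contDiff_iff_contDiffAt]
  intro x
  by_cases hx : x ∈ tsupport χ
  · exact hχ.contDiffAt.mul (hg x hx)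
  · refine (contDiffAt_const (c := (0 : ℂ))).congr_of_eventuallyEq ?_
    filter_upwards [notMem_tsupport_iff_eventuallyEq.1 hx] with y hy
    rw [hy, Pi.zero_apply, zero_mul]

/-- On each half-line, the solutions of `Π† y = i s y` are the multiples of `exp (-s / x) / x`:
testing the equation with `χ exp (s / x) / x` shows that `x exp (s / x) y` has vanishing
distributional derivative. -/
theorem exists_ae_eq_of_mem_adjoint {U : Set ℝ} (hU : IsOpen U) (hUc : U.OrdConnected)
    (hUn : U.Nonempty) (h0 : (0 : ℝ) ∉ U) {s : ℝ} {y : L2R}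
    (hy : (y, (s * Complex.I) • y) ∈ opPi.graph.adjoint) :
    ∃ c : ℂ, ∀ᵐ x, x ∈ U → y x = c * ((x⁻¹ * Real.exp (-s * x⁻¹) : ℝ) : ℂ) := by
  rw [opPi_graph_adjoint, mem_adjoint_opSchwartz_iff] at hy
  have hne : ∀ x ∈ U, x ≠ 0 := fun x hx h => h0 (h ▸ hx)
  let m : ℝ → ℂ := fun x => ((Real.exp (s * x⁻¹) : ℝ) : ℂ)
  have hm : ∀ x, x ≠ 0 → ContDiffAt ℝ ∞ m x := by
    intro x hx
    have h1 : ContDiffAt ℝ ∞ (fun x : ℝ => Real.exp (s * x⁻¹)) x :=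
      (contDiffAt_const.mul (contDiffAt_id.inv hx)).exp
    exact Complex.ofRealCLM.contDiff.contDiffAt.comp x h1
  have hmd : ∀ x, x ≠ 0 → HasDerivAt m (m x * (-s / x ^ 2 : ℝ)) x := by
    intro x hx
    have h1 := (((hasDerivAt_inv hx).const_mul s).exp).ofReal_comp
    convert h1 using 1
    simp only [m]
    push_cast
    ring
  have hv : LocallyIntegrableOn (fun x => (m x * x) * y x) U := by
    have hy1 : LocallyIntegrableOn (y : ℝ → ℂ) U :=
      ((Lp.memLp y).locallyIntegrable (by norm_num)).locallyIntegrableOn U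
    refine hy1.continuousOn_mul ?_ hU.isLocallyClosed
    intro x hx
    exact ((hm x (hne x hx)).continuousAt.mul Complex.continuous_ofReal.continuousAt).continuousWithinAt
  have main : ∀ χ : ℝ → ℝ, ContDiff ℝ ∞ χ → HasCompactSupport χ → tsupport χ ⊆ U →
      ∫ x, deriv χ x • (m x * x * y x) = 0 := by
    intro χ hχ hχc hχU
    have hχ1 : ContDiff ℝ ∞ fun x => (χ x : ℂ) := Complex.ofRealCLM.contDiff.comp hχ
    have hχ2 : tsupport (fun x => (χ x : ℂ)) = tsupport χ := by
      simp [tsupport, Function.support]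
    have hψs : ContDiff ℝ ∞ fun x => (χ x : ℂ) * (m x * (x : ℂ)⁻¹) := by
      refine contDiff_mul_of_tsupport hχ1 fun x hx => ?_
      have hx0 : x ≠ 0 := hne x (hχU (hχ2 ▸ hx))
      exact (hm x hx0).mul (Complex.ofRealCLM.contDiff.contDiffAt.inv
        (Complex.ofReal_ne_zero.2 hx0))
    have hψc : HasCompactSupport fun x => (χ x : ℂ) * (m x * (x : ℂ)⁻¹) := by
      refine HasCompactSupport.mul_right ?_
      rw [HasCompactSupport, hχ2]; exact hχc
    let ψ : 𝓢(ℝ, ℂ) := hψc.toSchwartzMap hψs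
    have hψ : ∀ x, ψ x = (χ x : ℂ) * (m x * (x : ℂ)⁻¹) := fun x => rfl
    have hS : ∀ x, x ≠ 0 → schwartzOp ψ x =
        Complex.I * (x * (((deriv χ x : ℝ) : ℂ) * m x + χ x * (m x * (-s / x ^ 2 : ℝ)))) := by
      intro x hx
      rw [schwartzOp_apply]
      congr 2
      have h1 : HasDerivAt (fun x => (χ x : ℂ) * m x)
          (((deriv χ x : ℝ) : ℂ) * m x + χ x * (m x * (-s / x ^ 2 : ℝ))) x :=
        ((hχ.differentiable (by simp)).differentiableAt.hasDerivAt.ofReal_comp).fun_mul (hmd x hx)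
      refine (h1.congr_of_eventuallyEq ?_).deriv
      filter_upwards [isOpen_ne.mem_nhds hx] with t ht
      have ht' : (t : ℂ) ≠ 0 := by exact_mod_cast ht
      rw [hψ]
      field_simp
    have key := hy ψ
    have i1 := L2.integrable_inner (𝕜 := ℂ) (schwartzIncl (schwartzOp ψ)) y
    have i2 := L2.integrable_inner (𝕜 := ℂ) (schwartzIncl ψ) ((s * Complex.I) • y)
    rw [L2.inner_def, L2.inner_def, ← sub_eq_zero, ← integral_sub i1 i2] at key
    have e : (fun x => deriv χ x • (m x * x * y x)) =ᵐ[volume]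
        fun x => Complex.I * (inner ℂ (schwartzIncl (schwartzOp ψ) x) (y x) -
          inner ℂ (schwartzIncl ψ x) (((s * Complex.I) • y : L2R) x)) := by
      filter_upwards [coeFn_schwartzIncl ψ, coeFn_schwartzIncl (schwartzOp ψ),
        Lp.coeFn_smul (s * Complex.I) y, ae_ne_zero] with x h1 h2 h3 hx
      have hx' : (x : ℂ) ≠ 0 := by exact_mod_cast hx
      have hmc : starRingEnd ℂ (m x) = m x := Complex.conj_ofReal _
      rw [h1, h2, h3, hS x hx, hψ, Pi.smul_apply, RCLike.inner_apply, RCLike.inner_apply]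
      simp only [map_mul, map_add, map_inv₀, Complex.conj_ofReal, Complex.conj_I, hmc, smul_eq_mul,
        Complex.real_smul]
      push_cast
      field_simp
      linear_combination (((deriv χ x : ℝ) : ℂ) * m x * x ^ 2 * y x) * Complex.I_sq
    rw [integral_congr_ae e, integral_const_mul, key, mul_zero]
  obtain ⟨c, hc⟩ := exists_ae_eq_const_of_integral_deriv hU hUc hUn hv main
  refine ⟨c, ?_⟩
  filter_upwards [hc] with x hx hxU
  have hx0 : (x : ℂ) ≠ 0 := by exact_mod_cast hne x hxU
  rw [← hx hxU]
  have : m x * Real.exp (-s * x⁻¹) = 1 := by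
    simp only [m]
    rw [← Complex.ofReal_mul, ← Real.exp_add]
    simp
  push_cast at this ⊢
  have hxx : (x : ℂ) * (x : ℂ)⁻¹ = 1 := mul_inv_cancel₀ hx0
  linear_combination (-(y x) * ((x : ℂ) * (x : ℂ)⁻¹)) * this - y x * hxx

theorem mem_uIoo_iff {a b x : ℝ} : x ∈ Set.uIoo a b ↔ a < x ∧ x < b ∨ b < x ∧ x < a := by
  rcases le_total a b with h | h
  · rw [Set.uIoo_of_le h, Set.mem_Ioo]
    exact ⟨Or.inl, fun h' => h'.resolve_right fun h'' => (h''.1.trans h''.2).not_ge h⟩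
  · rw [Set.uIoo_of_ge h, Set.mem_Ioo]
    exact ⟨Or.inr, fun h' => h'.resolve_left fun h'' => (h''.1.trans h''.2).not_ge h⟩

/-- A square integrable function does not dominate `1 / x` near the origin. -/
theorem eq_zero_of_ae_norm_le {b : ℝ} (hb : |b| = 1) {c : ℝ} (hc : 0 ≤ c) {y : L2R}
    (h : ∀ᵐ x, x ∈ Set.uIoo 0 b → c * |x|⁻¹ ≤ ‖y x‖) : c = 0 := by
  by_contra hc0
  have hb0 : b ≠ 0 := by rintro rfl; simp at hb
  have hi : Integrable fun x => ‖y x‖ ^ 2 :=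
    (memLp_two_iff_integrable_sq_norm (Lp.aestronglyMeasurable y)).1 (Lp.memLp y)
  have h1 : IntervalIntegrable (fun x : ℝ => x⁻¹) volume 0 b := by
    rw [intervalIntegrable_iff]
    refine ((hi.integrableOn (s := Set.uIoc 0 b)).const_mul (c ^ 2)⁻¹).mono'
      (by fun_prop) ?_
    rw [ae_restrict_iff' measurableSet_uIoc]
    have hbn : ∀ᵐ x : ℝ, x ≠ b := by simp [ae_iff]
    filter_upwards [h, ae_ne_zero, hbn] with x hx hx0 hxb hxm
    have hxm' : x ∈ Set.uIoo 0 b := by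
      rcases Set.mem_uIoc.1 hxm with ⟨h1, h2⟩ | ⟨h1, h2⟩
      · exact mem_uIoo_iff.2 (Or.inl ⟨h1, lt_of_le_of_ne h2 hxb⟩)
      · exact mem_uIoo_iff.2 (Or.inr ⟨h1, lt_of_le_of_ne h2 hx0⟩)
    have h2 := hx hxm'
    have hx1 : 1 ≤ |x|⁻¹ := by
      rw [one_le_inv₀ (abs_pos.2 hx0), ← hb]
      rcases Set.mem_uIoc.1 hxm with ⟨h1, h2⟩ | ⟨h1, h2⟩
      · exact abs_le_abs_of_nonneg h1.le h2
      · exact abs_le_abs_of_nonpos h2 h1.le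
    have h3 : (c * |x|⁻¹) ^ 2 ≤ ‖y x‖ ^ 2 := by gcongr
    rw [Real.norm_eq_abs, abs_inv]
    have hc2 : 0 < c ^ 2 := by positivity
    rw [inv_mul_eq_div, le_div_iff₀ hc2]
    refine le_trans ?_ h3
    rw [mul_pow, mul_comm]
    gcongr
    exact le_self_pow₀ hx1 two_ne_zero
  rw [intervalIntegrable_inv_iff] at h1
  rcases h1 with h1 | h1
  · exact hb0 h1.symm
  · exact h1 Set.left_mem_uIcc

/-- On the half-line where `exp (-s / x)` grows towards the origin, a non-zero multiple of
`exp (-s / x) / x` is not square integrable. -/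
theorem eq_zero_of_ae_eq {b s : ℝ} (hb : |b| = 1) (hbs : s * b < 0) {c : ℂ} {y : L2R}
    (h : ∀ᵐ x, x ∈ Set.uIoo 0 b → y x = c * ((x⁻¹ * Real.exp (-s * x⁻¹) : ℝ) : ℂ)) : c = 0 := by
  rw [← norm_eq_zero]
  refine eq_zero_of_ae_norm_le hb (norm_nonneg c) (y := y) ?_
  filter_upwards [h] with x hx hxm
  rw [hx hxm, norm_mul, Complex.norm_real, Real.norm_eq_abs, abs_mul, abs_inv, Real.abs_exp]
  refine mul_le_mul_of_nonneg_left ?_ (norm_nonneg c)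
  refine le_mul_of_one_le_right (by positivity) (Real.one_le_exp ?_)
  have hxb : 0 < x * b := by
    rcases mem_uIoo_iff.1 hxm with ⟨h1, h2⟩ | ⟨h1, h2⟩
    · exact mul_pos h1 (h1.trans h2)
    · exact mul_pos_of_neg_of_neg h2 (h1.trans h2)
  have hx0 : x ≠ 0 := left_ne_zero_of_mul hxb.ne'
  have : -s * x⁻¹ = (-(s * b)) * (x * b) / (x ^ 2 * b ^ 2) := by
    have hb0 : b ≠ 0 := right_ne_zero_of_mul hxb.ne'
    field_simp
  rw [this]
  have : 0 < -(s * b) := by linarith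
  positivity

theorem mem_span_ePos {y : L2R} (hy : (y, Complex.I • y) ∈ opPi.graph.adjoint) :
    y ∈ Submodule.span ℂ {ePos} := by
  have hy' : (y, (((1 : ℝ) : ℂ) * Complex.I) • y) ∈ opPi.graph.adjoint := by simpa using hy
  obtain ⟨c, hc⟩ := exists_ae_eq_of_mem_adjoint isOpen_Ioi Set.ordConnected_Ioi ⟨1, Set.mem_Ioi.2 one_pos⟩
    (lt_irrefl (0 : ℝ)) hy'
  obtain ⟨d, hd⟩ := exists_ae_eq_of_mem_adjoint isOpen_Iio Set.ordConnected_Iio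
    ⟨-1, Set.mem_Iio.2 neg_one_lt_zero⟩ (lt_irrefl (0 : ℝ)) hy'
  have hd0 : d = 0 := by
    refine eq_zero_of_ae_eq (b := -1) (s := 1) (by simp) (by norm_num) (y := y) ?_
    filter_upwards [hd] with x hx hxm
    refine hx ?_
    rcases mem_uIoo_iff.1 hxm with ⟨h1, h2⟩ | ⟨h1, h2⟩
    · exact absurd (h1.trans h2) (by norm_num)
    · exact h2
  refine Submodule.mem_span_singleton.2 ⟨c, ?_⟩
  apply Lp.ext
  filter_upwards [hc, hd, coeFn_ePos, Lp.coeFn_smul c ePos, ae_ne_zero] with x h1 h2 h3 h4 hx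
  rw [h4, Pi.smul_apply, h3]
  rcases lt_or_gt_of_ne hx with h0 | h0
  · rw [h2 h0, hd0, if_neg h0.not_gt]; simp
  · rw [h1 h0, if_pos h0]; simp

theorem mem_span_eNeg {y : L2R} (hy : (y, -Complex.I • y) ∈ opPi.graph.adjoint) :
    y ∈ Submodule.span ℂ {eNeg} := by
  have hy' : (y, (((-1 : ℝ) : ℂ) * Complex.I) • y) ∈ opPi.graph.adjoint := by simpa using hy
  obtain ⟨c, hc⟩ := exists_ae_eq_of_mem_adjoint isOpen_Ioi Set.ordConnected_Ioi ⟨1, Set.mem_Ioi.2 one_pos⟩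
    (lt_irrefl (0 : ℝ)) hy'
  obtain ⟨d, hd⟩ := exists_ae_eq_of_mem_adjoint isOpen_Iio Set.ordConnected_Iio
    ⟨-1, Set.mem_Iio.2 neg_one_lt_zero⟩ (lt_irrefl (0 : ℝ)) hy'
  have hc0 : c = 0 := by
    refine eq_zero_of_ae_eq (b := 1) (s := -1) (by simp) (by norm_num) (y := y) ?_
    filter_upwards [hc] with x hx hxm
    refine hx ?_
    rcases mem_uIoo_iff.1 hxm with ⟨h1, h2⟩ | ⟨h1, h2⟩
    · exact h1
    · exact absurd (h1.trans h2) (by norm_num)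
  refine Submodule.mem_span_singleton.2 ⟨d, ?_⟩
  apply Lp.ext
  filter_upwards [hc, hd, coeFn_eNeg, Lp.coeFn_smul d eNeg, ae_ne_zero] with x h1 h2 h3 h4 hx
  rw [h4, Pi.smul_apply, h3]
  rcases lt_or_gt_of_ne hx with h0 | h0
  · rw [h2 h0, if_pos h0]; simp
  · rw [h1 h0, hc0, if_neg h0.not_gt]; simp

theorem defectOne_opPi : DefectOne opPi ePos eNeg where
  dense := dense_opPi_domain
  closed := isClosable_opSchwartz.closure_isClosed
  symm := opPi_graph_le_adjoint
  mem_pos y := by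
    refine ⟨mem_span_ePos, fun h => ?_⟩
    obtain ⟨c, rfl⟩ := Submodule.mem_span_singleton.1 h
    rw [smul_comm]
    exact Submodule.smul_mem _ c ePos_mem_adjoint
  mem_neg y := by
    refine ⟨mem_span_eNeg, fun h => ?_⟩
    obtain ⟨c, rfl⟩ := Submodule.mem_span_singleton.1 h
    rw [smul_comm]
    exact Submodule.smul_mem _ c eNeg_mem_adjoint
  norm_eq := norm_ePos_eq_norm_eNeg
  ne_zero := ePos_ne_zero

/-! ### Diagonalization of `Π_0` -/

theorem image_inv_compl_zero : (fun x : ℝ => x⁻¹) '' {0}ᶜ = {0}ᶜ := by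
  ext x
  simp only [Set.mem_image, Set.mem_compl_iff, Set.mem_singleton_iff]
  exact ⟨by rintro ⟨y, hy, rfl⟩; exact inv_ne_zero hy, fun h => ⟨x⁻¹, inv_ne_zero h, inv_inv x⟩⟩

theorem lintegral_inv (g : ℝ → ENNReal) :
    ∫⁻ x, ENNReal.ofReal (x ^ 2)⁻¹ * g x⁻¹ = ∫⁻ x, g x := by
  have h := lintegral_image_eq_lintegral_abs_deriv_mul (s := {(0 : ℝ)}ᶜ) (f := fun x : ℝ => x⁻¹)
    (f' := fun x => -(x ^ 2)⁻¹) (measurableSet_singleton 0).compl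
    (fun x hx => (hasDerivAt_inv hx).hasDerivWithinAt) inv_injective.injOn g
  rw [image_inv_compl_zero, restrict_compl_singleton] at h
  rw [h]
  refine lintegral_congr fun x => ?_
  rw [abs_neg, abs_of_nonneg (by positivity)]

theorem quasiMeasurePreserving_inv :
    Measure.QuasiMeasurePreserving (fun x : ℝ => x⁻¹) volume volume := by
  refine ⟨measurable_inv, ?_⟩
  refine Measure.AbsolutelyContinuous.mk fun s hs h0 => ?_
  rw [Measure.map_apply measurable_inv hs]
  have h1 : (fun x : ℝ => x⁻¹) ⁻¹' s ⊆ (fun x : ℝ => x⁻¹) '' (s ∩ {0}ᶜ) ∪ {0} := by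
    intro x hx
    by_cases hx0 : x = 0
    · exact Or.inr hx0
    · exact Or.inl ⟨x⁻¹, ⟨hx, inv_ne_zero hx0⟩, inv_inv x⟩
  refine measure_mono_null h1 (measure_union_null ?_ (by simp))
  refine addHaar_image_eq_zero_of_differentiableOn_of_addHaar_eq_zero volume ?_
    (measure_mono_null Set.inter_subset_left h0)
  exact fun x hx => (differentiableAt_inv hx.2).differentiableWithinAt

theorem eLpNorm_inversion (f : ℝ → ℂ) :
    eLpNorm (fun x : ℝ => (x : ℂ)⁻¹ * f x⁻¹) 2 volume = eLpNorm f 2 volume := by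
  rw [eLpNorm_eq_lintegral_rpow_enorm_toReal two_ne_zero ENNReal.ofNat_ne_top,
    eLpNorm_eq_lintegral_rpow_enorm_toReal two_ne_zero ENNReal.ofNat_ne_top,
    ← lintegral_inv fun x => ‖f x‖ₑ ^ (2 : ENNReal).toReal]
  congr 1
  refine lintegral_congr fun x => ?_
  rw [enorm_mul, ENNReal.mul_rpow_of_nonneg _ _ (by norm_num)]
  congr 1
  rw [← ofReal_norm, ENNReal.ofReal_rpow_of_nonneg (norm_nonneg _) (by norm_num)]
  congr 1
  simp

theorem memLp_inversion (f : L2R) :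
    MemLp (fun x : ℝ => (x : ℂ)⁻¹ * f x⁻¹) 2 (volume : Measure ℝ) := by
  refine ⟨?_, ?_⟩
  · refine (by fun_prop : Measurable fun x : ℝ => (x : ℂ)⁻¹).aestronglyMeasurable.mul ?_
    exact (Lp.aestronglyMeasurable f).comp_quasiMeasurePreserving quasiMeasurePreserving_inv
  · rw [eLpNorm_inversion]
    exact (Lp.memLp f).2

/-- The map `f ↦ x⁻¹ f (x⁻¹)` on `L²(ℝ)`. -/
def inversionFun (f : L2R) : L2R := (memLp_inversion f).toLp _

theorem coeFn_inversionFun (f : L2R) :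
    inversionFun f =ᵐ[volume] fun x : ℝ => (x : ℂ)⁻¹ * f x⁻¹ := (memLp_inversion f).coeFn_toLp

theorem inversionFun_inversionFun (f : L2R) : inversionFun (inversionFun f) = f := by
  apply Lp.ext
  filter_upwards [coeFn_inversionFun (inversionFun f),
    quasiMeasurePreserving_inv.ae (coeFn_inversionFun f), ae_ne_zero] with x h1 h2 hx
  have hx' : (x : ℂ) ≠ 0 := by exact_mod_cast hx
  rw [h1, h2, inv_inv]
  push_cast
  field_simp

/-- The unitary involution `f ↦ x⁻¹ f (x⁻¹)` of `L²(ℝ)`. It turns `-i d/du` into `i x (d/dx) x`. -/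
def inversion : L2R ≃ₗᵢ[ℂ] L2R where
  toFun := inversionFun
  invFun := inversionFun
  left_inv := inversionFun_inversionFun
  right_inv := inversionFun_inversionFun
  map_add' f g := by
    apply Lp.ext
    filter_upwards [coeFn_inversionFun (f + g), coeFn_inversionFun f, coeFn_inversionFun g,
      quasiMeasurePreserving_inv.ae (Lp.coeFn_add f g),
      Lp.coeFn_add (inversionFun f) (inversionFun g)] with x h1 h2 h3 h4 h5
    rw [h1, h5, Pi.add_apply, h2, h3, h4, Pi.add_apply, mul_add]
  map_smul' c f := by
    apply Lp.ext
    filter_upwards [coeFn_inversionFun (c • f), coeFn_inversionFun f,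
      quasiMeasurePreserving_inv.ae (Lp.coeFn_smul c f),
      Lp.coeFn_smul c (inversionFun f)] with x h1 h2 h3 h4
    rw [RingHom.id_apply, h1, h4, Pi.smul_apply, h2, h3, Pi.smul_apply, smul_eq_mul, smul_eq_mul,
      mul_left_comm]
  norm_map' f := by
    change ‖inversionFun f‖ = ‖f‖
    rw [Lp.norm_def, Lp.norm_def, eLpNorm_congr_ae (coeFn_inversionFun f), eLpNorm_inversion]

theorem coeFn_inversion (f : L2R) :
    inversion f =ᵐ[volume] fun x : ℝ => (x : ℂ)⁻¹ * f x⁻¹ := coeFn_inversionFun f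

theorem inversion_inversion (f : L2R) : inversion (inversion f) = f := inversionFun_inversionFun f

/-- The operator `-i d/du` on the Schwartz space. -/
def momentum (f : 𝓢(ℝ, ℂ)) : 𝓢(ℝ, ℂ) := -Complex.I • SchwartzMap.derivCLM ℂ ℂ f

theorem momentum_apply (f : 𝓢(ℝ, ℂ)) (x : ℝ) : momentum f x = -Complex.I * deriv f x := by
  change -Complex.I • SchwartzMap.derivCLM ℂ ℂ f x = _
  rw [SchwartzMap.derivCLM_apply, smul_eq_mul]

theorem isRep_inversion_schwartz (f : 𝓢(ℝ, ℂ)) :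
    IsRep (inversion (schwartzIncl f)) (inversion (schwartzIncl (momentum f)))
      (fun x => f x⁻¹) (fun x => -(x ^ 2 : ℂ)⁻¹ * deriv f x⁻¹) where
  deriv x hx := by
    have := (f.hasDerivAt x⁻¹).scomp x (hasDerivAt_inv hx)
    have e : -(x ^ 2 : ℂ)⁻¹ * deriv f x⁻¹ = (-(x ^ 2)⁻¹ : ℝ) • deriv f x⁻¹ := by
      rw [Complex.real_smul]
      push_cast
      rfl
    rw [e]
    exact this
  fst := by
    filter_upwards [coeFn_inversion (schwartzIncl f),
      quasiMeasurePreserving_inv.ae (coeFn_schwartzIncl f)] with x h1 h2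
    rw [h1, h2]
  snd := by
    filter_upwards [coeFn_inversion (schwartzIncl (momentum f)),
      quasiMeasurePreserving_inv.ae (coeFn_schwartzIncl (momentum f)), ae_ne_zero] with x h1 h2 hx
    have hx' : (x : ℂ) ≠ 0 := by exact_mod_cast hx
    rw [h1, h2, momentum_apply]
    field_simp

theorem graph_opPiExt (θ : ℝ) : (opPiExt θ).graph =
    opPi.graph ⊔ Submodule.span ℂ {(zeta θ, zeta (θ + Real.pi))} := by
  rw [opPiExt, zeta_pair_eq]
  exact defectOne_opPi.graph_extension (Complex.exp_ne_zero _)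

theorem isSelfAdjoint_opPiExt (θ : ℝ) : IsSelfAdjoint (opPiExt θ) := by
  rw [opPiExt, zeta_pair_eq]
  refine defectOne_opPi.isSelfAdjoint_extension (Complex.norm_exp_ofReal_mul_I _) ?_
  rw [← Complex.ofReal_neg]
  exact Complex.norm_exp_ofReal_mul_I _

theorem adjoint_graph_opPiExt (θ : ℝ) : (opPiExt θ).graph.adjoint = (opPiExt θ).graph :=
  (isSelfAdjoint_iff_graph (isSelfAdjoint_opPiExt θ).dense_domain).1 (isSelfAdjoint_opPiExt θ)

/-- The functions `f (1 / x) / x` with `f` in the Schwartz space belong to the domain of `Π_0`: in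
the boundary form with `ζ_0`, the terms at `+∞` and `-∞` are both `f 0` and cancel. -/
theorem inversion_schwartz_mem (f : 𝓢(ℝ, ℂ)) :
    (inversion (schwartzIncl f), inversion (schwartzIncl (momentum f))) ∈ (opPiExt 0).graph := by
  obtain ⟨C, hC⟩ := schwartzMap_bounded f
  have hS : (inversion (schwartzIncl f), inversion (schwartzIncl (momentum f))) ∈
      opPi.graph.adjoint := by
    rw [opPi_graph_adjoint, mem_adjoint_opSchwartz_iff]
    exact (isRep_inversion_schwartz f).inner_schwartz_eq fun x => hC _
  have hζ : inner ℂ (zeta Real.pi) (inversion (schwartzIncl f)) =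
      inner ℂ (zeta 0) (inversion (schwartzIncl (momentum f))) := by
    refine isRep_zeta_zero.inner_eq (isRep_inversion_schwartz f) (l := f 0) ?_ ?_
    · simp only [Complex.conj_ofReal]
      exact tendsto_exp_neg_inv_abs_zero.zero_mul_isBoundedUnder_le
        (isBoundedUnder_of ⟨C, fun x => hC _⟩)
    · simp only [Complex.conj_ofReal]
      have h1 : Tendsto (fun x : ℝ => x⁻¹) (cocompact ℝ) (𝓝 0) := by
        rw [← Metric.cobounded_eq_cocompact]
        exact tendsto_inv₀_cobounded
      have h2 := tendsto_exp_neg_inv_abs_cocompact.mul ((f.continuous.tendsto 0).comp h1)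
      simpa only [one_mul, Function.comp_def] using h2
  rw [← adjoint_graph_opPiExt, graph_opPiExt, zero_add, mem_adjoint_iff_inner_eq]
  intro a b hab
  obtain ⟨s, hs, t, ht, hst⟩ := Submodule.mem_sup.1 hab
  obtain ⟨d, rfl⟩ := Submodule.mem_span_singleton.1 ht
  obtain ⟨rfl, rfl⟩ := Prod.ext_iff.1 hst
  have h1 := inner_eq_of_mem_adjoint hS hs
  simp only [Prod.fst_add, Prod.snd_add, Prod.smul_fst, Prod.smul_snd, inner_add_left,
    inner_smul_left, h1, hζ]

/-- The inversion followed by the Fourier transform. -/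
def spectralTransform : L2R ≃ₗᵢ[ℂ] L2R :=
  inversion.trans (Lp.fourierTransformₗᵢ ℝ ℂ)

theorem spectralTransform_inversion_schwartz (f : 𝓢(ℝ, ℂ)) :
    spectralTransform (inversion (schwartzIncl f)) = schwartzIncl (𝓕 f) := by
  change Lp.fourierTransformₗᵢ ℝ ℂ (inversion (inversion (schwartzIncl f))) = _
  rw [inversion_inversion]
  exact SchwartzMap.toLp_fourier_eq f

theorem fourier_momentum (f : 𝓢(ℝ, ℂ)) (ξ : ℝ) :
    𝓕 (momentum f) ξ = ((2 * Real.pi * ξ : ℝ) : ℂ) * 𝓕 f ξ := by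
  have h1 : 𝓕 (momentum f) = -Complex.I • 𝓕 (SchwartzMap.derivCLM ℂ ℂ f) :=
    FourierTransform.fourier_smul _ _
  have h2 : (SchwartzMap.derivCLM ℂ ℂ f : ℝ → ℂ) = deriv f :=
    funext (SchwartzMap.derivCLM_apply ℂ f)
  rw [h1, smul_apply, SchwartzMap.fourier_coe, h2,
    Real.fourier_deriv f.integrable f.differentiable
      (by rw [← h2]; exact (SchwartzMap.derivCLM ℂ ℂ f).integrable), SchwartzMap.fourier_coe]
  simp only [smul_eq_mul]
  push_cast
  linear_combination (-2 * Real.pi * ξ * 𝓕 (f : ℝ → ℂ) ξ) * Complex.I_mul_I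

/-- The unitary `W` diagonalizes `A`: it turns `A` into the maximal operator of multiplication by
`2 π ξ`. -/
def IsDiagonalizedBy (A : L2R →ₗ.[ℂ] L2R) (W : L2R ≃ₗᵢ[ℂ] L2R) : Prop :=
  ∀ x y : L2R, (x, y) ∈ A.graph ↔
    W y =ᵐ[volume] fun ξ : ℝ => ((2 * Real.pi * ξ : ℝ) : ℂ) * W x ξ

/-- For self-adjoint `A` one inclusion suffices, since multiplication by `2 π ξ` is symmetric. -/
theorem isDiagonalizedBy_of_imp {A : L2R →ₗ.[ℂ] L2R} (hA : IsSelfAdjoint A) {W : L2R ≃ₗᵢ[ℂ] L2R}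
    (h : ∀ x y : L2R, (x, y) ∈ A.graph →
      W y =ᵐ[volume] fun ξ : ℝ => ((2 * Real.pi * ξ : ℝ) : ℂ) * W x ξ) :
    IsDiagonalizedBy A W := by
  refine fun x y => ⟨h x y, fun hxy => ?_⟩
  rw [← (isSelfAdjoint_iff_graph hA.dense_domain).1 hA, mem_adjoint_iff_inner_eq]
  intro a b hab
  rw [← W.inner_map_map b x, ← W.inner_map_map a y, L2.inner_def, L2.inner_def]
  refine integral_congr_ae ?_
  filter_upwards [h a b hab, hxy] with ξ h1 h2
  rw [h1, h2, RCLike.inner_apply, RCLike.inner_apply, map_mul, Complex.conj_ofReal]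
  ring

/-- Testing the symmetry of `Π_0` against the functions whose transform is a test function. -/
theorem isDiagonalizedBy_opPiExt_zero : IsDiagonalizedBy (opPiExt 0) spectralTransform := by
  refine isDiagonalizedBy_of_imp (isSelfAdjoint_opPiExt 0) fun x y hxy => ?_
  have key : ∀ G : 𝓢(ℝ, ℂ), ∃ M : 𝓢(ℝ, ℂ), (∀ ξ, M ξ = ((2 * Real.pi * ξ : ℝ) : ℂ) * G ξ) ∧
      inner ℂ (schwartzIncl M) (spectralTransform x) =
        inner ℂ (schwartzIncl G) (spectralTransform y) := by
    intro G
    have hG : 𝓕 (𝓕⁻ G) = G := FourierTransform.fourier_fourierInv_eq G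
    refine ⟨𝓕 (momentum (𝓕⁻ G)), fun ξ => by rw [fourier_momentum, hG], ?_⟩
    have hm := inversion_schwartz_mem (𝓕⁻ G)
    rw [← adjoint_graph_opPiExt] at hxy
    have := inner_eq_of_mem_adjoint hxy hm
    rw [← spectralTransform.inner_map_map, ← spectralTransform.inner_map_map (inversion _),
      spectralTransform_inversion_schwartz, spectralTransform_inversion_schwartz, hG] at this
    exact this
  have hl : ∀ z : L2R, LocallyIntegrable (z : ℝ → ℂ) := fun z =>
    (Lp.memLp z).locallyIntegrable (by norm_num)
  have hl2 : LocallyIntegrable fun ξ : ℝ =>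
      ((2 * Real.pi * ξ : ℝ) : ℂ) * spectralTransform x ξ := by
    have := ((hl (spectralTransform x)).locallyIntegrableOn Set.univ).continuousOn_mul
      (g := fun ξ : ℝ => ((2 * Real.pi * ξ : ℝ) : ℂ))
      (by fun_prop) isOpen_univ.isLocallyClosed
    rwa [locallyIntegrableOn_univ] at this
  have h0 := ae_eq_zero_of_integral_contDiff_smul_eq_zero (μ := volume)
    ((hl (spectralTransform y)).sub hl2) ?_
  · filter_upwards [h0] with ξ hξ
    exact sub_eq_zero.1 hξ
  intro g hg hgc
  have hg1 : ContDiff ℝ ∞ fun x => (g x : ℂ) := Complex.ofRealCLM.contDiff.comp hg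
  have hg2 : HasCompactSupport fun x => (g x : ℂ) := hgc.comp_left Complex.ofReal_zero
  obtain ⟨M, hM, hk⟩ := key (hg2.toSchwartzMap hg1)
  have i1 := L2.integrable_inner (𝕜 := ℂ) (schwartzIncl M) (spectralTransform x)
  have i2 := L2.integrable_inner (𝕜 := ℂ) (schwartzIncl (hg2.toSchwartzMap hg1))
    (spectralTransform y)
  rw [L2.inner_def, L2.inner_def, eq_comm, ← sub_eq_zero, ← integral_sub i2 i1] at hk
  rw [← hk]
  refine integral_congr_ae ?_
  filter_upwards [coeFn_schwartzIncl M, coeFn_schwartzIncl (hg2.toSchwartzMap hg1)] with ξ h1 h2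
  have h3 : hg2.toSchwartzMap hg1 ξ = (g ξ : ℂ) := rfl
  rw [h1, h2, hM, h3, RCLike.inner_apply, RCLike.inner_apply, map_mul, Complex.conj_ofReal,
    Complex.conj_ofReal, Complex.real_smul, Pi.sub_apply]
  ring

/-! ### The spectrum of a multiplication operator -/

theorem memLp_bounded_mul {r : ℝ → ℂ} (hr : Measurable r) {C : ℝ} (hC : ∀ ξ, ‖r ξ‖ ≤ C)
    (f : L2R) : MemLp (fun ξ => r ξ * f ξ) 2 (volume : Measure ℝ) := by
  refine (Lp.memLp f).of_le_mul (c := C)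
    (hr.aestronglyMeasurable.mul (Lp.aestronglyMeasurable f)) ?_
  filter_upwards with ξ
  rw [norm_mul]
  exact mul_le_mul_of_nonneg_right (hC ξ) (norm_nonneg _)

/-- Multiplication by a bounded measurable function on `L²(ℝ)`. -/
def boundedMul {r : ℝ → ℂ} (hr : Measurable r) {C : ℝ} (hC : ∀ ξ, ‖r ξ‖ ≤ C) : L2R →L[ℂ] L2R :=
  LinearMap.mkContinuous
    { toFun := fun f => (memLp_bounded_mul hr hC f).toLp _
      map_add' := fun f g => by
        apply Lp.ext
        filter_upwards [(memLp_bounded_mul hr hC (f + g)).coeFn_toLp,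
          (memLp_bounded_mul hr hC f).coeFn_toLp, (memLp_bounded_mul hr hC g).coeFn_toLp,
          Lp.coeFn_add f g,
          Lp.coeFn_add ((memLp_bounded_mul hr hC f).toLp _) ((memLp_bounded_mul hr hC g).toLp _)]
          with x h1 h2 h3 h4 h5
        rw [h1, h5, Pi.add_apply, h2, h3, h4, Pi.add_apply, mul_add]
      map_smul' := fun c f => by
        apply Lp.ext
        filter_upwards [(memLp_bounded_mul hr hC (c • f)).coeFn_toLp,
          (memLp_bounded_mul hr hC f).coeFn_toLp, Lp.coeFn_smul c f,
          Lp.coeFn_smul c ((memLp_bounded_mul hr hC f).toLp _)] with x h1 h2 h3 h4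
        rw [RingHom.id_apply, h1, h4, Pi.smul_apply, h2, h3, Pi.smul_apply, smul_eq_mul,
          smul_eq_mul, mul_left_comm] }
    C fun f => by
      refine Lp.norm_le_mul_norm_of_ae_le_mul ?_
      filter_upwards [(memLp_bounded_mul hr hC f).coeFn_toLp] with x h
      change ‖((memLp_bounded_mul hr hC f).toLp _ : ℝ → ℂ) x‖ ≤ _
      rw [h, norm_mul]
      exact mul_le_mul_of_nonneg_right (hC x) (norm_nonneg _)

theorem coeFn_boundedMul {r : ℝ → ℂ} (hr : Measurable r) {C : ℝ} (hC : ∀ ξ, ‖r ξ‖ ≤ C) (f : L2R) :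
    boundedMul hr hC f =ᵐ[volume] fun ξ => r ξ * f ξ := (memLp_bounded_mul hr hC f).coeFn_toLp

theorem sub_ne_zero_of_im_ne_zero {z : ℂ} (hz : z.im ≠ 0) (t : ℝ) : (t : ℂ) - z ≠ 0 := by
  intro h
  apply hz
  have := congrArg Complex.im h
  simpa using this

theorem norm_inv_sub_le {z : ℂ} (hz : z.im ≠ 0) (t : ℝ) : ‖((t : ℂ) - z)⁻¹‖ ≤ |z.im|⁻¹ := by
  rw [norm_inv]
  refine inv_anti₀ (abs_pos.2 hz) ?_
  have := Complex.abs_im_le_norm ((t : ℂ) - z)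
  simpa using this

/-- The resolvent of multiplication by `2 π ξ`. -/
def mulResolvent {z : ℂ} (hz : z.im ≠ 0) : L2R →L[ℂ] L2R :=
  boundedMul (r := fun ξ : ℝ => (((2 * Real.pi * ξ : ℝ) : ℂ) - z)⁻¹) (by fun_prop)
    fun ξ => norm_inv_sub_le hz (2 * Real.pi * ξ)

theorem coeFn_mulResolvent {z : ℂ} (hz : z.im ≠ 0) (f : L2R) : mulResolvent hz f =ᵐ[volume]
    fun ξ => (((2 * Real.pi * ξ : ℝ) : ℂ) - z)⁻¹ * f ξ := coeFn_boundedMul _ _ f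

namespace IsDiagonalizedBy

variable {A : L2R →ₗ.[ℂ] L2R} {W : L2R ≃ₗᵢ[ℂ] L2R} (h : IsDiagonalizedBy A W)
include h

theorem resolvent_mem_graph {z : ℂ} (hz : z.im ≠ 0) (y : L2R) :
    (W.symm (mulResolvent hz (W y)), y + z • W.symm (mulResolvent hz (W y))) ∈ A.graph := by
  rw [h, map_add, map_smul, W.apply_symm_apply]
  filter_upwards [Lp.coeFn_add (W y) (z • mulResolvent hz (W y)),
    Lp.coeFn_smul z (mulResolvent hz (W y)), coeFn_mulResolvent hz (W y)] with ξ h1 h2 h3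
  rw [h1, Pi.add_apply, h2, Pi.smul_apply, h3, smul_eq_mul]
  have := sub_ne_zero_of_im_ne_zero hz (2 * Real.pi * ξ)
  field_simp
  ring

theorem mem_resolventSet {z : ℂ} (hz : z.im ≠ 0) : z ∈ resolventSet A := by
  refine ⟨(W.symm.toContinuousLinearEquiv : L2R →L[ℂ] L2R) ∘L mulResolvent hz ∘L
    (W.toContinuousLinearEquiv : L2R →L[ℂ] L2R), fun y => ?_, fun x => ?_⟩
  · obtain ⟨u, hu1, hu2⟩ := (LinearPMap.mem_graph_iff A).1 (h.resolvent_mem_graph hz y)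
    have hu1' : W.symm (mulResolvent hz (W y)) = u := hu1.symm
    change ∃ h : W.symm (mulResolvent hz (W y)) ∈ A.domain,
      A ⟨W.symm (mulResolvent hz (W y)), h⟩ - z • W.symm (mulResolvent hz (W y)) = y
    refine ⟨hu1' ▸ u.2, ?_⟩
    have : (⟨W.symm (mulResolvent hz (W y)), hu1' ▸ u.2⟩ : A.domain) = u := Subtype.ext hu1'
    rw [this, hu2, add_sub_cancel_right]
  · change W.symm (mulResolvent hz (W (A x - z • (x : L2R)))) = x
    rw [LinearIsometryEquiv.symm_apply_eq]
    apply Lp.ext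
    have hx := (h x (A x)).1 (A.mem_graph x)
    rw [map_sub, map_smul]
    filter_upwards [hx, coeFn_mulResolvent hz (W (A x) - z • W x),
      Lp.coeFn_sub (W (A x)) (z • W x), Lp.coeFn_smul z (W x)] with ξ h1 h2 h3 h4
    rw [h2, h3, Pi.sub_apply, h4, Pi.smul_apply, h1, smul_eq_mul]
    have := sub_ne_zero_of_im_ne_zero hz (2 * Real.pi * ξ)
    field_simp

/-- A real number is in the spectrum, because the indicator functions of short intervals are
approximate eigenvectors. -/
theorem ofReal_notMem_resolventSet (t : ℝ) : (t : ℂ) ∉ resolventSet A := by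
  rintro ⟨R, -, hR⟩
  -- on an interval of length `ε` at `t / 2π` one has `|2 π ξ - t| ≤ 1 / (‖R‖ + 1)`
  set ε : ℝ := (2 * Real.pi * (‖R‖ + 1))⁻¹ with hε
  have hRp : 0 < ‖R‖ + 1 := by positivity
  have hεp : 0 < ε := by positivity
  set a : ℝ := t / (2 * Real.pi)
  let S : Set ℝ := Set.Icc a (a + ε)
  have hS : MeasurableSet S := measurableSet_Icc
  have hSv : (volume : Measure ℝ) S ≠ ⊤ := by simp [S]
  let g : L2R := indicatorConstLp 2 hS hSv (1 : ℂ)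
  have hg : g =ᵐ[volume] S.indicator fun _ => (1 : ℂ) := indicatorConstLp_coeFn
  have hgn : ‖g‖ ≠ 0 := by
    rw [norm_indicatorConstLp two_ne_zero ENNReal.ofNat_ne_top]
    have hv : volume.real S = ε := by simp [S, Measure.real, hεp.le]
    rw [hv]
    simp only [norm_one, one_mul]
    positivity
  have hsub : ∀ ξ ∈ S, |2 * Real.pi * ξ - t| ≤ 2 * Real.pi * ε := by
    intro ξ hξ
    have ht : t = 2 * Real.pi * a := by
      simp only [a]
      field_simp
    rw [ht, ← mul_sub, abs_mul, abs_of_pos Real.two_pi_pos]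
    refine mul_le_mul_of_nonneg_left ?_ Real.two_pi_pos.le
    rw [abs_of_nonneg (by linarith [hξ.1])]
    linarith [hξ.2]
  have hm : Measurable (S.indicator fun ξ : ℝ => ((2 * Real.pi * ξ : ℝ) : ℂ)) :=
    (by fun_prop : Measurable fun ξ : ℝ => ((2 * Real.pi * ξ : ℝ) : ℂ)).indicator hS
  have hb : ∀ ξ, ‖S.indicator (fun ξ : ℝ => ((2 * Real.pi * ξ : ℝ) : ℂ)) ξ‖ ≤
      2 * Real.pi * ε + |t| := by
    intro ξ
    by_cases hξ : ξ ∈ S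
    · rw [Set.indicator_of_mem hξ, Complex.norm_real, Real.norm_eq_abs]
      have h1 := hsub ξ hξ
      have h2 := abs_add_le (2 * Real.pi * ξ - t) t
      rw [sub_add_cancel] at h2
      linarith
    · rw [Set.indicator_of_notMem hξ, norm_zero]
      positivity
  have hgr : (W.symm g, W.symm (boundedMul hm hb g)) ∈ A.graph := by
    rw [h, W.apply_symm_apply, W.apply_symm_apply]
    filter_upwards [coeFn_boundedMul hm hb g, hg] with ξ h1 h2
    rw [h1, h2]
    by_cases hξ : ξ ∈ S
    · rw [Set.indicator_of_mem hξ, Set.indicator_of_mem hξ]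
    · rw [Set.indicator_of_notMem hξ, Set.indicator_of_notMem hξ, mul_zero, mul_zero]
  obtain ⟨x, hx1, hx2⟩ := (LinearPMap.mem_graph_iff A).1 hgr
  have h1 := hR x
  rw [hx1, hx2] at h1
  simp only at h1
  have h2 : ‖W.symm (boundedMul hm hb g) - (t : ℂ) • W.symm g‖ ≤ (2 * Real.pi * ε) * ‖g‖ := by
    rw [← map_smul, ← map_sub, LinearIsometryEquiv.norm_map]
    refine Lp.norm_le_mul_norm_of_ae_le_mul ?_
    filter_upwards [coeFn_boundedMul hm hb g, hg, Lp.coeFn_sub (boundedMul hm hb g) ((t : ℂ) • g),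
      Lp.coeFn_smul (t : ℂ) g] with ξ h1 h2 h3 h4
    rw [h3, Pi.sub_apply, h1, h4, Pi.smul_apply, h2, smul_eq_mul]
    by_cases hξ : ξ ∈ S
    · rw [Set.indicator_of_mem hξ, Set.indicator_of_mem hξ, mul_one, mul_one, norm_one, mul_one,
        ← Complex.ofReal_sub, Complex.norm_real]
      exact hsub ξ hξ
    · rw [Set.indicator_of_notMem hξ, Set.indicator_of_notMem hξ]
      simp
  have h3 : ‖g‖ ≤ ‖R‖ * ((2 * Real.pi * ε) * ‖g‖) := by
    calc ‖g‖ = ‖W.symm g‖ := (LinearIsometryEquiv.norm_map _ _).symm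
      _ = ‖R (W.symm (boundedMul hm hb g) - (t : ℂ) • W.symm g)‖ := by rw [h1]
      _ ≤ ‖R‖ * ‖W.symm (boundedMul hm hb g) - (t : ℂ) • W.symm g‖ := R.le_opNorm _
      _ ≤ _ := mul_le_mul_of_nonneg_left h2 (norm_nonneg _)
  have h4 : 2 * Real.pi * ε * (‖R‖ + 1) = 1 := by
    rw [hε]
    field_simp
  have h5 : 0 < ‖g‖ := lt_of_le_of_ne (norm_nonneg _) (Ne.symm hgn)
  have h6 : 0 < 2 * Real.pi * ε * ‖g‖ := by positivity
  nlinarith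

theorem opSpectrum_eq : opSpectrum A = Set.range fun t : ℝ => (t : ℂ) := by
  ext z
  rw [opSpectrum, Set.mem_compl_iff, Set.mem_range]
  constructor
  · intro hz
    by_contra hcon
    refine hz (h.mem_resolventSet fun him => hcon ⟨z.re, Complex.ext rfl him.symm⟩)
  · rintro ⟨t, rfl⟩
    exact h.ofReal_notMem_resolventSet t

/-- The spectral measure at `ψ` is the image of `|W ψ|² dξ` under `ξ ↦ 2 π ξ`. -/
theorem mem_acVectors (ψ : L2R) : ψ ∈ acVectors A := by
  have hm : AEMeasurable (fun ξ => ‖W ψ ξ‖ₑ ^ 2) volume :=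
    (Lp.aestronglyMeasurable (W ψ)).enorm.pow_const 2
  have hlt : ∫⁻ ξ, ‖W ψ ξ‖ₑ ^ 2 < ⊤ := by
    have := (eLpNorm_lt_top_iff_lintegral_rpow_enorm_lt_top two_ne_zero
      ENNReal.ofNat_ne_top).1 (Lp.memLp (W ψ)).2
    simpa using this
  have hM : Measurable fun ξ : ℝ => 2 * Real.pi * ξ := by fun_prop
  refine ⟨((volume : Measure ℝ).withDensity fun ξ => ‖W ψ ξ‖ₑ ^ 2).map
    fun ξ => 2 * Real.pi * ξ, ⟨?_, ?_⟩, ?_⟩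
  · have : IsFiniteMeasure ((volume : Measure ℝ).withDensity fun ξ => ‖W ψ ξ‖ₑ ^ 2) :=
      isFiniteMeasure_withDensity hlt.ne
    exact Measure.isFiniteMeasure_map _ _
  · intro z hz
    obtain ⟨φ, h1, h2⟩ := (LinearPMap.mem_graph_iff A).1 (h.resolvent_mem_graph hz ψ)
    refine ⟨φ, ?_, ?_⟩
    · rw [h2, h1]
      exact add_sub_cancel_right _ _
    · rw [h1, integral_map hM.aemeasurable
        (by fun_prop : Measurable fun t : ℝ => ((t : ℂ) - z)⁻¹).aestronglyMeasurable,
        integral_withDensity_eq_integral_toReal_smul₀ hm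
          (Eventually.of_forall fun ξ => by simp)]
      rw [← W.inner_map_map, W.apply_symm_apply, L2.inner_def]
      refine integral_congr_ae ?_
      filter_upwards [coeFn_mulResolvent hz (W ψ)] with ξ h3
      rw [h3, RCLike.inner_apply, mul_assoc, Complex.mul_conj']
      simp [mul_comm]
  · refine ((withDensity_absolutelyContinuous _ _).map hM).trans ?_
    rw [Real.map_volume_mul_left Real.two_pi_pos.ne']
    exact Measure.smul_absolutelyContinuous

end IsDiagonalizedBy

section Part

variable {H : Type*} [NormedAddCommGroup H] [InnerProductSpace ℂ H]

theorem opSpectrum_partIn_top (A : H →ₗ.[ℂ] H) : opSpectrum (partIn A ⊤) = opSpectrum A := by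
  rw [opSpectrum, opSpectrum]
  congr 1
  ext z
  let ι : (⊤ : Submodule ℂ H) →L[ℂ] H := (⊤ : Submodule ℂ H).subtypeL
  let κ : H →L[ℂ] (⊤ : Submodule ℂ H) :=
    (ContinuousLinearMap.id ℂ H).codRestrict ⊤ fun _ => Submodule.mem_top
  constructor
  · rintro ⟨R, h1, h2⟩
    refine ⟨ι ∘L R ∘L κ, fun y => ?_, fun x => ?_⟩
    · obtain ⟨⟨h3, h4⟩, h5⟩ := h1 (κ y)
      exact ⟨h3, congrArg Subtype.val h5⟩
    · exact congrArg Subtype.val (h2 ⟨⟨x, Submodule.mem_top⟩, x.2, Submodule.mem_top⟩)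
  · rintro ⟨R, h1, h2⟩
    refine ⟨κ ∘L R ∘L ι, fun y => ?_, fun x => ?_⟩
    · obtain ⟨h3, h4⟩ := h1 (y : H)
      exact ⟨⟨h3, Submodule.mem_top⟩, Subtype.ext h4⟩
    · exact Subtype.ext (h2 ⟨(x : (⊤ : Submodule ℂ H)), x.2.fst⟩)

theorem acSpectrum_eq_opSpectrum {A : H →ₗ.[ℂ] H} (h : acVectors A = Set.univ) :
    acSpectrum A = opSpectrum A := by
  have hK : acSubspace A = ⊤ := by
    rw [acSubspace, h, Submodule.span_univ]
    exact top_le_iff.1 (Submodule.le_topologicalClosure _)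
  rw [acSpectrum, hK, opSpectrum_partIn_top]

theorem mem_graph_unitaryConj {U : H ≃ₗᵢ[ℂ] H} {A : H →ₗ.[ℂ] H} {x y : H} :
    (x, y) ∈ (unitaryConj U A).graph ↔ (U.symm x, U.symm y) ∈ A.graph := by
  simp only [LinearPMap.mem_graph_iff]
  constructor
  · rintro ⟨u, rfl, rfl⟩
    refine ⟨⟨U.symm u, u.2⟩, rfl, ?_⟩
    change _ = U.symm (U (A ⟨U.symm u, u.2⟩))
    rw [U.symm_apply_apply]
  · rintro ⟨v, h1, h2⟩
    have h3 : U.symm x = v := h1.symm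
    refine ⟨⟨x, ?_⟩, rfl, ?_⟩
    · change U.symm x ∈ A.domain
      exact h3 ▸ v.2
    · change U (A ⟨U.symm x, _⟩) = y
      have : (⟨U.symm x, h3 ▸ v.2⟩ : A.domain) = v := Subtype.ext h3
      rw [this, h2]
      exact U.apply_symm_apply y

end Part

theorem IsDiagonalizedBy.unitaryConj {A : L2R →ₗ.[ℂ] L2R} {W : L2R ≃ₗᵢ[ℂ] L2R}
    (h : IsDiagonalizedBy A W) (U : L2R ≃ₗᵢ[ℂ] L2R) :
    IsDiagonalizedBy (unitaryConj U A) (U.symm.trans W) := by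
  intro x y
  rw [mem_graph_unitaryConj, h]
  rfl

/-! ### The family `Π_θ` -/

theorem unitaryL_symm_apply (θ : ℝ) (f : L2R) : (unitaryL θ).symm f = unitaryL (-θ) f := rfl

theorem unitaryL_ePos (θ : ℝ) :
    unitaryL θ ePos = Complex.exp ((θ / 2 : ℝ) * Complex.I) • ePos := by
  have e : unitaryL θ ePos = (1 / 2 : ℂ) • (zeta θ - Complex.I • zeta (θ + Real.pi)) := by
    conv_lhs => rw [ePos]
    rw [map_smul, map_sub, map_smul, unitaryL_zeta, unitaryL_zeta, zero_add, add_comm Real.pi]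
  rw [e, zeta_add_pi, zeta_eq]
  generalize Complex.exp ((θ / 2 : ℝ) * Complex.I) = p
  generalize Complex.exp (-(θ / 2 : ℝ) * Complex.I) = q
  have := Complex.I_mul_I
  match_scalars
  · linear_combination (-p / 2) * this
  · linear_combination (q / 2) * this

theorem unitaryL_eNeg (θ : ℝ) :
    unitaryL θ eNeg = Complex.exp (-(θ / 2 : ℝ) * Complex.I) • eNeg := by
  have e : unitaryL θ eNeg = (1 / 2 : ℂ) • (zeta θ + Complex.I • zeta (θ + Real.pi)) := by
    conv_lhs => rw [eNeg]
    rw [map_smul, map_add, map_smul, unitaryL_zeta, unitaryL_zeta, zero_add, add_comm Real.pi]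
  rw [e, zeta_add_pi, zeta_eq]
  generalize Complex.exp ((θ / 2 : ℝ) * Complex.I) = p
  generalize Complex.exp (-(θ / 2 : ℝ) * Complex.I) = q
  have := Complex.I_mul_I
  match_scalars
  · linear_combination (p / 2) * this
  · linear_combination (-q / 2) * this

/-- The boundary form with an eigenvector of a unitary `U` is preserved by `U`. -/
theorem inner_map_eq_of_eigenvector {H : Type*} [NormedAddCommGroup H] [InnerProductSpace ℂ H]
    (U : H ≃ₗᵢ[ℂ] H) {e y w : H} {p k : ℂ} (hp : p ≠ 0) (hU : U e = p • e)
    (h : inner ℂ w e = inner ℂ y (k • e)) : inner ℂ (U w) e = inner ℂ (U y) (k • e) := by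
  rw [← U.inner_map_map w e, ← U.inner_map_map y (k • e), map_smul, hU, inner_smul_right,
    inner_smul_right, inner_smul_right] at h
  rw [inner_smul_right]
  exact mul_left_cancel₀ hp (by linear_combination h)

/-- The unitaries `L_θ` preserve the graph of `Π`, although they do not preserve the Schwartz
space: `L_θ ψ` jumps at the origin. It is in the domain of `Π†`, and its boundary form with `e±`
vanishes because `e±` are eigenvectors of `L_θ`. -/
theorem unitaryL_mem_opPi_graph (θ : ℝ) {x y : L2R} (h : (x, y) ∈ opPi.graph) :
    (unitaryL θ x, unitaryL θ y) ∈ opPi.graph := by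
  have hc : IsClosed {p : L2R × L2R | (unitaryL θ p.1, unitaryL θ p.2) ∈ opPi.graph} := by
    have h1 : Continuous fun p : L2R × L2R => (unitaryL θ p.1, unitaryL θ p.2) :=
      ((unitaryL θ).continuous.comp continuous_fst).prodMk
        ((unitaryL θ).continuous.comp continuous_snd)
    exact IsClosed.preimage h1 defectOne_opPi.closed
  rw [opPi_graph] at h
  refine closure_minimal (fun p hp => ?_) hc h
  obtain ⟨f, rfl⟩ := mem_graph_opSchwartz.1 hp
  refine defectOne_opPi.mem_graph_of_inner
    (by rw [opPi_graph_adjoint]; exact unitaryL_schwartz_mem θ f) ?_ ?_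
  · refine inner_map_eq_of_eigenvector _ (Complex.exp_ne_zero _) (unitaryL_ePos θ) ?_
    exact mem_adjoint_iff_inner_eq.1 (opPi_graph_adjoint ▸ ePos_mem_adjoint) _ _ hp
  · refine inner_map_eq_of_eigenvector _ (Complex.exp_ne_zero _) (unitaryL_eNeg θ) ?_
    exact mem_adjoint_iff_inner_eq.1 (opPi_graph_adjoint ▸ eNeg_mem_adjoint) _ _ hp

theorem unitaryL_mem_opPiExt_graph (θ φ : ℝ) {x y : L2R} (h : (x, y) ∈ (opPiExt φ).graph) :
    (unitaryL θ x, unitaryL θ y) ∈ (opPiExt (φ + θ)).graph := by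
  rw [graph_opPiExt] at h ⊢
  obtain ⟨s, hs, t, ht, hst⟩ := Submodule.mem_sup.1 h
  obtain ⟨d, rfl⟩ := Submodule.mem_span_singleton.1 ht
  obtain ⟨rfl, rfl⟩ := Prod.ext_iff.1 hst
  refine Submodule.mem_sup.2 ⟨_, unitaryL_mem_opPi_graph θ hs, _,
    Submodule.smul_mem _ d (Submodule.mem_span_singleton_self _), ?_⟩
  simp only [Prod.fst_add, Prod.snd_add, map_add, map_smul, unitaryL_zeta, Prod.smul_mk,
    Prod.mk_add_mk, add_right_comm φ θ]

theorem opPiExt_eq_unitaryConj (θ : ℝ) :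
    opPiExt θ = unitaryConj (unitaryL θ) (opPiExt 0) := by
  apply LinearPMap.eq_of_eq_graph
  ext ⟨x, y⟩
  rw [mem_graph_unitaryConj, unitaryL_symm_apply, unitaryL_symm_apply]
  constructor
  · intro h
    simpa using unitaryL_mem_opPiExt_graph (-θ) θ h
  · intro h
    have := unitaryL_mem_opPiExt_graph θ 0 h
    rw [zero_add] at this
    rwa [← unitaryL_symm_apply, ← unitaryL_symm_apply, LinearIsometryEquiv.apply_symm_apply,
      LinearIsometryEquiv.apply_symm_apply] at this

theorem isDiagonalizedBy_opPiExt (θ : ℝ) :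
    IsDiagonalizedBy (opPiExt θ) ((unitaryL θ).symm.trans spectralTransform) := by
  rw [opPiExt_eq_unitaryConj]
  exact isDiagonalizedBy_opPiExt_zero.unitaryConj (unitaryL θ)

theorem deficiencySubspace_eq_span {H : Type*} [NormedAddCommGroup H] [InnerProductSpace ℂ H]
    [CompleteSpace H] {S : H →ₗ.[ℂ] H} (hd : Dense (S.domain : Set H)) {z : ℂ} {e : H}
    (h : ∀ y, (y, z • y) ∈ S.graph.adjoint ↔ y ∈ Submodule.span ℂ {e}) :
    deficiencySubspace S z = Submodule.span ℂ {e} := by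
  ext y
  rw [← h, ← LinearPMap.adjoint_graph_eq_graph_adjoint hd, LinearPMap.mem_graph_iff]
  constructor
  · rintro ⟨h1, h2⟩
    exact ⟨⟨y, h1⟩, rfl, h2⟩
  · rintro ⟨u, rfl, h2⟩
    exact ⟨u.2, h2⟩

theorem rank_span_of_ne_zero {H : Type*} [AddCommGroup H] [Module ℂ H] {e : H} (he : e ≠ 0) :
    Module.rank ℂ (Submodule.span ℂ {e}) = 1 := by
  rw [← Module.finrank_eq_rank, finrank_span_singleton he, Nat.cast_one]

theorem DefectOne.deficiencyIndices_eq {H : Type*} [NormedAddCommGroup H] [InnerProductSpace ℂ H]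
    [CompleteSpace H] {S : H →ₗ.[ℂ] H} {ep em : H} (h : DefectOne S ep em) :
    deficiencyIndices S = (1, 1) := by
  have hem : em ≠ 0 := by rw [← norm_ne_zero_iff, ← h.norm_eq, norm_ne_zero_iff]; exact h.ne_zero
  rw [deficiencyIndices, deficiencySubspace_eq_span h.dense h.mem_pos,
    deficiencySubspace_eq_span h.dense h.mem_neg, rank_span_of_ne_zero h.ne_zero,
    rank_span_of_ne_zero hem]

theorem opPi_isFormalAdjoint : opPi.IsFormalAdjoint opPi := fun x y =>
  mem_adjoint_iff_inner_eq.1 (opPi_graph_le_adjoint (opPi.mem_graph y)) _ _ (opPi.mem_graph x)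

theorem opPi_le_opPiExt (θ : ℝ) : opPi ≤ opPiExt θ := by
  rw [← LinearPMap.le_graph_iff, graph_opPiExt]
  exact le_sup_left

theorem zeta_mem_opPiExt_graph (θ : ℝ) :
    (zeta θ, zeta (θ + Real.pi)) ∈ (opPiExt θ).graph := by
  rw [graph_opPiExt]
  exact Submodule.mem_sup_right (Submodule.mem_span_singleton_self _)

theorem mem_opPiExt_domain_iff (θ : ℝ) (φ : L2R) : φ ∈ (opPiExt θ).domain ↔
    ∃ ψ ∈ opPi.domain, ∃ c : ℂ, φ = ψ + c • zeta θ := by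
  constructor
  · intro h
    obtain ⟨w, hw⟩ := LinearPMap.mem_domain_iff.1 h
    rw [graph_opPiExt] at hw
    obtain ⟨s, hs, t, ht, hst⟩ := Submodule.mem_sup.1 hw
    obtain ⟨c, rfl⟩ := Submodule.mem_span_singleton.1 ht
    exact ⟨s.1, LinearPMap.mem_domain_of_mem_graph hs, c, (Prod.ext_iff.1 hst).1.symm⟩
  · rintro ⟨ψ, hψ, c, rfl⟩
    exact add_mem ((opPi_le_opPiExt θ).1 hψ)
      (Submodule.smul_mem _ c (LinearPMap.mem_domain_of_mem_graph (zeta_mem_opPiExt_graph θ)))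

theorem opPiExt_apply (θ : ℝ) (ψ : opPi.domain) (c : ℂ) (φ : (opPiExt θ).domain)
    (h : (φ : L2R) = ψ + c • zeta θ) : opPiExt θ φ = opPi ψ + c • zeta (θ + Real.pi) := by
  have h1 := add_mem (LinearPMap.le_graph_of_le (opPi_le_opPiExt θ) (opPi.mem_graph ψ))
    (Submodule.smul_mem _ c (zeta_mem_opPiExt_graph θ))
  exact LinearPMap.mem_graph_snd_inj _ ((opPiExt θ).mem_graph φ) h1 h

theorem periodic_opPiExt : Function.Periodic opPiExt (2 * Real.pi) := by
  intro θ
  have h1 : θ + 2 * Real.pi + Real.pi = θ + Real.pi + 2 * Real.pi := by ring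
  rw [opPiExt, opPiExt, h1, zeta_add_two_pi, zeta_add_two_pi, ← Prod.neg_mk,
    ← Set.neg_singleton, Submodule.span_neg]

theorem exp_half_sq (θ : ℝ) :
    Complex.exp ((θ / 2 : ℝ) * Complex.I) * Complex.exp ((θ / 2 : ℝ) * Complex.I) =
      Complex.exp (θ * Complex.I) := by
  rw [← Complex.exp_add]
  congr 1
  push_cast
  ring

theorem exp_half_mul_exp_neg_half (θ : ℝ) :
    Complex.exp ((θ / 2 : ℝ) * Complex.I) * Complex.exp (-(θ / 2 : ℝ) * Complex.I) = 1 := by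
  rw [← Complex.exp_add, ← Complex.exp_zero]
  congr 1
  ring

/-- `ζ_θ` and `ζ_φ` are proportional modulo the domain of `Π` only if `exp (i θ) = exp (i φ)`. -/
theorem exp_eq_exp_of_opPiExt_eq {θ φ : ℝ} (h : opPiExt θ = opPiExt φ) :
    Complex.exp (θ * Complex.I) = Complex.exp (φ * Complex.I) := by
  have h1 := LinearPMap.mem_domain_of_mem_graph (zeta_mem_opPiExt_graph θ)
  rw [h, mem_opPiExt_domain_iff] at h1
  obtain ⟨ψ, hψ, c, hc⟩ := h1
  obtain rfl : ψ = zeta θ - c • zeta φ := by rw [hc, add_sub_cancel_right]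
  rw [← exp_half_sq θ, ← exp_half_sq φ]
  have hθ := exp_half_mul_exp_neg_half θ
  have hφ := exp_half_mul_exp_neg_half φ
  rw [zeta_eq, zeta_eq] at hψ
  generalize Complex.exp ((θ / 2 : ℝ) * Complex.I) = p at *
  generalize Complex.exp (-(θ / 2 : ℝ) * Complex.I) = q at *
  generalize Complex.exp ((φ / 2 : ℝ) * Complex.I) = r at *
  generalize Complex.exp (-(φ / 2 : ℝ) * Complex.I) = s at *
  have h2 : (p - c * r) • ePos + (q - c * s) • eNeg ∈ opPi.domain := by
    convert hψ using 1
    module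
  obtain ⟨h3, h4⟩ := defectOne_opPi.eq_zero_of_mem_domain h2
  -- `p = c r` and `1 / p = c / r`
  have h5 : p = c * r := sub_eq_zero.1 h3
  have h6 : q = c * s := sub_eq_zero.1 h4
  have h7 : p * s = q * r := by rw [h5, h6]; ring
  linear_combination (-p * p) * hφ + (p * r) * h7 + (r * r) * hθ

theorem injOn_opPiExt : Set.InjOn opPiExt (Set.Ico 0 (2 * Real.pi)) := by
  intro θ hθ φ hφ h
  obtain ⟨n, hn⟩ := Complex.exp_eq_exp_iff_exists_int.1 (exp_eq_exp_of_opPiExt_eq h)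
  have h1 : ((θ - φ - n * (2 * Real.pi) : ℝ) : ℂ) * Complex.I = 0 := by
    push_cast
    linear_combination hn
  have h2 : θ - φ - n * (2 * Real.pi) = 0 :=
    Complex.ofReal_eq_zero.1 ((mul_eq_zero.1 h1).resolve_right Complex.I_ne_zero)
  have hpi := Real.two_pi_pos
  have h3 : (n : ℝ) < 1 := by
    by_contra! hcon
    nlinarith [hθ.2, hφ.1]
  have h4 : (-1 : ℝ) < n := by
    by_contra! hcon
    nlinarith [hθ.1, hφ.2]
  have h5 : n = 0 := by
    have h6 : n < 1 := by exact_mod_cast h3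
    have h7 : -1 < n := by exact_mod_cast h4
    omega
  subst h5
  simpa [sub_eq_zero] using h2

/-- The angle of an extension containing `α e₊ + β e₋` is the argument of `α / β`. -/
theorem exists_opPiExt_eq {A : L2R →ₗ.[ℂ] L2R} (hle : opPi ≤ A) (hA : IsSelfAdjoint A) :
    ∃ θ, opPiExt θ = A := by
  obtain ⟨α, β, hα, hβ, hmem⟩ := defectOne_opPi.exists_defectPair_mem hA hle
  set θ := (α * starRingEnd ℂ β).arg
  have hθ : Complex.exp (θ * Complex.I) = α * starRingEnd ℂ β := by
    have := Complex.norm_mul_exp_arg_mul_I (α * starRingEnd ℂ β)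
    rwa [norm_mul, RCLike.norm_conj, hα, hβ, one_mul, Complex.ofReal_one, one_mul] at this
  refine ⟨θ, eq_of_le_of_isSelfAdjoint (isSelfAdjoint_opPiExt θ) hA ?_⟩
  rw [← LinearPMap.le_graph_iff, graph_opPiExt]
  refine sup_le (LinearPMap.le_graph_of_le hle) ((Submodule.span_singleton_le_iff_mem _ _).2 ?_)
  have hα1 : α * starRingEnd ℂ α = 1 := by rw [Complex.mul_conj', hα]; norm_num
  have hβ1 : β * starRingEnd ℂ β = 1 := by rw [Complex.mul_conj', hβ]; norm_num
  rw [zeta_pair_eq]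
  have h1 := exp_half_mul_exp_neg_half θ
  rw [← exp_half_sq] at hθ
  have h0 := Complex.exp_ne_zero ((θ / 2 : ℝ) * Complex.I)
  generalize Complex.exp ((θ / 2 : ℝ) * Complex.I) = p at *
  generalize Complex.exp (-(θ / 2 : ℝ) * Complex.I) = q at *
  have e1 : p * starRingEnd ℂ α * α = p := by linear_combination p * hα1
  have e2 : p * starRingEnd ℂ α * β = q := by
    refine mul_left_cancel₀ h0 ?_
    linear_combination (starRingEnd ℂ α * β) * hθ - h1 + (β * starRingEnd ℂ β) * hα1 + hβ1
  convert Submodule.smul_mem _ (p * starRingEnd ℂ α) hmem using 1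
  simp only [defectPair, Prod.smul_mk, smul_add, smul_sub, smul_smul, Prod.mk.injEq]
  rw [mul_left_comm _ Complex.I, mul_left_comm _ Complex.I, e1, e2]
  exact ⟨rfl, rfl⟩

theorem bijOn_opPiExt : Set.BijOn opPiExt (Set.Ico 0 (2 * Real.pi))
    {A | opPi ≤ A ∧ IsSelfAdjoint A} := by
  refine ⟨fun θ _ => ⟨opPi_le_opPiExt θ, isSelfAdjoint_opPiExt θ⟩, injOn_opPiExt, ?_⟩
  rintro A ⟨hle, hA⟩
  obtain ⟨θ, rfl⟩ := exists_opPiExt_eq hle hA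
  obtain ⟨φ, hφ, h⟩ := periodic_opPiExt.exists_mem_Ico₀ Real.two_pi_pos θ
  exact ⟨φ, hφ, h.symm⟩

end

end ThermalHamiltonian

theorem theorem2p4 :
    -- `Π` is a densely defined closed symmetric operator with deficiency indices `(1, 1)`
    (Dense (opPi.domain : Set L2R) ∧
      opPi.IsClosed ∧
      opPi.IsFormalAdjoint opPi ∧
      deficiencyIndices opPi = (1, 1)) ∧
    -- domain and action of `Π_θ`
    (∀ θ : ℝ,
      (∀ φ : L2R, φ ∈ (opPiExt θ).domain ↔
        ∃ ψ ∈ opPi.domain, ∃ c : ℂ, φ = ψ + c • zeta θ) ∧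
      (∀ (ψ : opPi.domain) (c : ℂ) (φ : (opPiExt θ).domain),
        (φ : L2R) = ψ + c • zeta θ →
        opPiExt θ φ =
          opPi ψ + c • zeta (θ + Real.pi))) ∧
    -- `Π_θ` depends only on `θ` modulo `2π`, and the angles in `[0, 2π)` correspond one-to-one
    -- to the self-adjoint extensions of `Π`
    Function.Periodic opPiExt (2 * Real.pi) ∧
    Set.BijOn opPiExt (Set.Ico 0 (2 * Real.pi))
      {A | opPi ≤ A ∧ IsSelfAdjoint A} ∧
    -- unitary equivalence `Π_θ = L_θ Π_0 L_θ*`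
    (∀ θ : ℝ, opPiExt θ =
      unitaryConj (unitaryL θ)
        (opPiExt 0)) ∧
    -- the spectrum is purely absolutely continuous and equal to the real line
    (∀ θ : ℝ,
      acVectors (opPiExt θ) = Set.univ ∧
      opSpectrum (opPiExt θ) =
        acSpectrum (opPiExt θ) ∧
      acSpectrum (opPiExt θ) =
        Set.range (fun t : ℝ => (t : ℂ))) := by
  refine ⟨⟨dense_opPi_domain, defectOne_opPi.closed, opPi_isFormalAdjoint,
    defectOne_opPi.deficiencyIndices_eq⟩,
    fun θ => ⟨mem_opPiExt_domain_iff θ, opPiExt_apply θ⟩, periodic_opPiExt, bijOn_opPiExt,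
    opPiExt_eq_unitaryConj, fun θ => ?_⟩
  have hd := isDiagonalizedBy_opPiExt θ
  have hac : acVectors (opPiExt θ) = Set.univ := Set.eq_univ_of_forall hd.mem_acVectors
  exact ⟨hac, (acSpectrum_eq_opSpectrum hac).symm, (acSpectrum_eq_opSpectrum hac).trans
    hd.opSpectrum_eq⟩
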